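/- \textbf{Theorem (Geometric fabric stability).} Let $\mathcal Q\subseteq\mathbb R^d$ be open. Let $\mathcal L_g(q,v)$, $q\in\mathcal Q$, $v\in\mathbb R^d$, be a Finsler structure: $C^2$ where $v\ne 0$; $\mathcal L_g\ge 0$, with equality if and only if $v=0$; $\mathcal L_g(q,\alpha v)=\alpha\mathcal L_g(q,v)$ for $\alpha\ge 0$; and, for $\mathcal L_e=\tfrac12\mathcal L_g^2$, the mass $M(q,v)=\partial^2_{vv}\mathcal L_e$ is positive definite for $v\neq 0$. Put $\xi=\partial_{vq}\mathcal L_e\,v-\partial_q\mathcal L_e$ and $p=\partial_v\mathcal L_e$. Let $f(q,v)$ be a bending term: $v^{T}f(q,v)=0$, $f(q,\alpha v)=\alpha^2f(q,v)$ for $\alpha\ge 0$, and $f$ is continuous where $v\neq0$. Let $c=(c_j)$ and $g=(g_i)$ be finite, possibly empty, families of real $C^2$ functions on $\mathcal Q$, let $F=\{q\in\mathcal Q: c(q)=0,\ g(q)\ge 0\}$ be the constrained domain, and suppose that at every $q\in F$ the gradients of all $c_j$ and of all active $g_i$ (those with $g_i(q)=0$) are linearly independent. Let $\psi$ be $C^1$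 on $\mathcal Q$ and bounded below on $F$, and let $B(q,v)$ be a continuous, bounded, pointwise positive definite damping matrix. Fix $\beta\in\mathbb R$. A \emph{motion} is a continuous curve $q:[0,\infty)\to F$ whose right derivative $v=\dot q$ exists at every $t\geq 0$, is right continuous, has left limits $v(t^-)$ for $t>0$, and satisfies the following, where $J^T(\lambda,\eta)=\sum_j\lambda_j\nabla c_j+\sum_i\eta_i\nabla g_i$, and $\eta$ is called admissible at $q$ if $\eta_i\le 0$ and $\eta_i g_i(q)=0$ for all $i$. (a) (Equation of motion.) For all $t>0$ outside a countable set of times, $v$ is differentiable at $t$ and, for some $\lambda$, some admissible $\eta$ and some $r$ (all depending on $t$), $$M(q,v)\ddot q+\xi(q,v)+f(q,v)+J(q)^T(\lambda,\eta)=-\nabla\psi(q)-B(q,v)v+r ,$$ where $r$ is an optional additional dissipation of the contact model: $r^{T}v\le 0$, $\|r\|\le\beta\|v\|$, and $r=0$ if no $g_i$ is active. (Where $v=0$, $M$ denotes $\partial^2_{vv}\mathcal L_e$ if $\partial_v\mathcal L_e$ is differentiable in $v$ there and $0$ otherwise.) (b) (Impact law.) For all $t>0$ there are $\lambda$ and an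 admissible $\eta$ at $q(t)$ with $p(q,v(t))-p(q,v(t^-))=-J(q)^T(\lambda,\eta)$, and $\mathcal L_e(q,v(t))\le\mathcal L_e(q,v(t^-))$, where $q=q(t)$: impulses come from the active constraints, and impacts conserve or dissipate energy. A \emph{KKT point} of the problem of minimizing $\psi(q)$ subject to $q\in\mathcal Q$, $c(q)=0$, $g(q)\ge 0$ is a $q\in F$ with $J(q)^T(\lambda,\eta)=-\nabla\psi(q)$ for some $\lambda$ and some admissible $\eta$; this is the first-order condition for a local minimum. Then for every motion: (1) With $\mathcal H=\mathcal L_e+\psi$, the function $t\mapsto v^TB(q,v)v$ is integrable on $[0,\infty)$, $\mathcal H(t)\le\mathcal H(s)-\int_s^t v^TB(q,v)v\,dr$ for $0\le s\le t$, and $\mathcal H(t)$ converges to a finite limit as $t\to\infty$. (2) Every accumulation point in $\mathcal Q$ of $q(t)$ as $t\to\infty$ is a KKT point, and for every compact $K\subseteq \mathcal Q$, $v(t)\to 0$ as $t\to\infty$ along the times with $q(t)\in K$. (3) If $q(t)$ stays in some compact subset of $\mathcal Q$ for all large $t$, then $v(t)\to0$, the set of KKT points is non-empty, and the distance from $q(t)$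 to it tends to $0$. If moreover every KKT point is isolated in the set of KKT points, then $q(t)$ converges to a KKT point. -/

import Mathlib

open Set Filter Topology MeasureTheory

noncomputable section

/-- Coordinate space `ℝᵈ` with its Euclidean structure. -/
abbrev Coord (d : ℕ) := EuclideanSpace ℝ (Fin d)

/-- The energy `½ Lg²` of a Finsler structure `Lg(q, v)`. -/
def finslerEnergy {d : ℕ} (Lg : Coord d → Coord d → ℝ) (q v : Coord d) : ℝ :=
  1 / 2 * (Lg q v) ^ 2

/-- The generalized momentum `∂_v L`. -/
def momentum {d : ℕ} (L : Coord d → Coord d → ℝ) (q v : Coord d) : Coord d :=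
  gradient (fun w => L q w) v

/-- The mass (metric) `M = ∂²_{vv} L`. -/
def mass {d : ℕ} (L : Coord d → Coord d → ℝ) (q v : Coord d) : Coord d →L[ℝ] Coord d :=
  fderiv ℝ (fun w => momentum L q w) v

/-- The geometric term `ξ = ∂_{vq} L v - ∂_q L`. -/
def geomTerm {d : ℕ} (L : Coord d → Coord d → ℝ) (q v : Coord d) : Coord d :=
  fderiv ℝ (fun x => momentum L x v) q v - gradient (fun x => L x v) q

/-- Finsler structures over a coordinate domain `Q`: smooth (here `C²`) away from zero velocity,
positive, positively homogeneous of degree one, with positive definite mass. -/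
structure IsFinslerStructure {d : ℕ} (Q : Set (Coord d)) (Lg : Coord d → Coord d → ℝ) :
    Prop where
  contDiffOn : ContDiffOn ℝ 2 (fun x : Coord d × Coord d => Lg x.1 x.2) (Q ×ˢ {0}ᶜ)
  nonneg : ∀ q ∈ Q, ∀ v, 0 ≤ Lg q v
  eq_zero_iff : ∀ q ∈ Q, ∀ v, Lg q v = 0 ↔ v = 0
  homogeneous : ∀ q ∈ Q, ∀ v, ∀ α : ℝ, 0 ≤ α → Lg q (α • v) = α * Lg q v
  mass_posDef : ∀ q ∈ Q, ∀ v, v ≠ 0 → ∀ u, u ≠ 0 →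
    0 < inner ℝ u (mass (finslerEnergy Lg) q v u)

/-- Bending terms: zero-work forces, positively homogeneous of degree two in the velocity. -/
structure IsBendingTerm {d : ℕ} (Q : Set (Coord d)) (f : Coord d → Coord d → Coord d) :
    Prop where
  continuousOn : ContinuousOn (fun x : Coord d × Coord d => f x.1 x.2) (Q ×ˢ {0}ᶜ)
  homogeneous : ∀ q ∈ Q, ∀ v, ∀ α : ℝ, 0 ≤ α → f q (α • v) = α ^ 2 • f q v
  zero_work : ∀ q ∈ Q, ∀ v, inner ℝ v (f q v) = 0

/-- Bounded positive definite damping matrices `B(q, v)` (symmetry is not needed). -/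
structure IsDamping {d : ℕ} (Q : Set (Coord d))
    (B : Coord d → Coord d → Coord d →L[ℝ] Coord d) : Prop where
  continuousOn : ContinuousOn (fun x : Coord d × Coord d => B x.1 x.2) (Q ×ˢ univ)
  posDef : ∀ q ∈ Q, ∀ v u, u ≠ 0 → 0 < inner ℝ u (B q v u)
  bounded : ∃ b : ℝ, ∀ q ∈ Q, ∀ v, ‖B q v‖ ≤ b

/-- The constrained domain `c(q) = 0`, `g(q) ≥ 0`. -/
def feasibleSet {d : ℕ} {ι κ : Type*} (Q : Set (Coord d)) (c : ι → Coord d → ℝ)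
    (g : κ → Coord d → ℝ) : Set (Coord d) :=
  {q | q ∈ Q ∧ (∀ j, c j q = 0) ∧ ∀ i, 0 ≤ g i q}

/-- The Jacobian of `c` together with the active part of `g` has full row rank at every point of
the constrained domain. -/
def FullRankConstraints {d : ℕ} {ι κ : Type*} (Q : Set (Coord d)) (c : ι → Coord d → ℝ)
    (g : κ → Coord d → ℝ) : Prop :=
  ∀ q ∈ feasibleSet Q c g, LinearIndependent ℝ
    (Sum.elim (fun j : ι => gradient (c j) q)
      (fun i : {i : κ // g i q = 0} => gradient (g i) q))

/-- The term `Jᵀ(q) (lam, η)` of the constraints `(c, g)`. -/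
def constraintTerm {d : ℕ} {ι κ : Type*} [Fintype ι] [Fintype κ] (c : ι → Coord d → ℝ)
    (g : κ → Coord d → ℝ) (q : Coord d) (lam : ι → ℝ) (η : κ → ℝ) : Coord d :=
  ∑ j, lam j • gradient (c j) q + ∑ i, η i • gradient (g i) q

/-- Sign and complementarity conditions for the multipliers `η` of `g ≥ 0`. The constraint term
stands on the left-hand side of the equations of motion, so the force that it exerts is
`-η i • ∇ (g i)`, which pushes into the domain exactly when `η i ≤ 0`. -/
def Complementary {d : ℕ} {κ : Type*} (g : κ → Coord d → ℝ) (q : Coord d) (η : κ → ℝ) : Prop :=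
  ∀ i, η i ≤ 0 ∧ η i * g i q = 0

/-- KKT points of `min ψ` subject to `c = 0`, `g ≥ 0`. -/
def kktSet {d : ℕ} {ι κ : Type*} [Fintype ι] [Fintype κ] (Q : Set (Coord d))
    (ψ : Coord d → ℝ) (c : ι → Coord d → ℝ) (g : κ → Coord d → ℝ) : Set (Coord d) :=
  {q | q ∈ feasibleSet Q c g ∧ ∃ (lam : ι → ℝ) (η : κ → ℝ),
    Complementary g q η ∧ constraintTerm c g q lam η = -gradient ψ q}

/-- The equation of motion at one instant, with position `q`, velocity `v` and acceleration `a`: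
`M a + ξ + f + Jᵀλ = -∂ψ - B v + r`, where only constraints that are active at `q` carry a
multiplier. The force `r` is an optional dissipation of the contact model: it acts only in contact,
does no positive work and is at most `β` times the speed. -/
def EquationOfMotion {d : ℕ} {ι κ : Type*} [Fintype ι] [Fintype κ]
    (Lg : Coord d → Coord d → ℝ) (f : Coord d → Coord d → Coord d) (ψ : Coord d → ℝ)
    (B : Coord d → Coord d → Coord d →L[ℝ] Coord d) (c : ι → Coord d → ℝ)
    (g : κ → Coord d → ℝ) (β : ℝ) (q v a : Coord d) : Prop :=
  ∃ (lam : ι → ℝ) (η : κ → ℝ) (r : Coord d),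
    Complementary g q η ∧
    ((∀ i, g i q ≠ 0) → r = 0) ∧ inner ℝ v r ≤ 0 ∧ ‖r‖ ≤ β * ‖v‖ ∧
    mass (finslerEnergy Lg) q v a + geomTerm (finslerEnergy Lg) q v + f q v
        + constraintTerm c g q lam η
      = -gradient ψ q - B q v v + r

/-- The impact law at position `q`, from velocity `vm` to velocity `vp`: the momentum jumps by an
impulse of the active constraints, and the energy does not increase. (`vp = vm` is allowed.) -/
def ImpactLaw {d : ℕ} {ι κ : Type*} [Fintype ι] [Fintype κ]
    (Lg : Coord d → Coord d → ℝ) (c : ι → Coord d → ℝ)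
    (g : κ → Coord d → ℝ) (q vm vp : Coord d) : Prop :=
  (∃ (lam : ι → ℝ) (η : κ → ℝ), Complementary g q η ∧
    momentum (finslerEnergy Lg) q vp - momentum (finslerEnergy Lg) q vm
      + constraintTerm c g q lam η = 0) ∧
  finslerEnergy Lg q vp ≤ finslerEnergy Lg q vm

/-- Motions `q(t)`, `t ≥ 0`, of the forced and constrained fabric. The position is continuous and
feasible, the velocity `v` is right continuous with left limits and obeys the impact law at every
time, and the equation of motion holds outside a countable set of times (impacts, which may
accumulate, changes of the active set, and instants at which the velocity passes through zero,
where a Finsler metric has no value). -/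
structure IsMotion {d : ℕ} {ι κ : Type*} [Fintype ι] [Fintype κ] (Q : Set (Coord d))
    (Lg : Coord d → Coord d → ℝ) (f : Coord d → Coord d → Coord d) (ψ : Coord d → ℝ)
    (B : Coord d → Coord d → Coord d →L[ℝ] Coord d) (c : ι → Coord d → ℝ)
    (g : κ → Coord d → ℝ) (β : ℝ) (q v : ℝ → Coord d) : Prop where
  feasible : ∀ t, 0 ≤ t → q t ∈ feasibleSet Q c g
  continuousOn : ContinuousOn q (Ici 0)
  velocity : ∀ t, 0 ≤ t → HasDerivWithinAt q (v t) (Ici t) t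
  right_continuous : ∀ t, 0 ≤ t → ContinuousWithinAt v (Ici t) t
  impact : ∀ t, 0 < t → ∃ vm, Tendsto v (𝓝[<] t) (𝓝 vm) ∧ ImpactLaw Lg c g (q t) vm (v t)
  equation : ∃ S : Set ℝ, S.Countable ∧ ∀ t, 0 < t → t ∉ S →
    ∃ a, HasDerivAt v a t ∧ EquationOfMotion Lg f ψ B c g β (q t) (v t) a

/-- The total energy `Lₑ + ψ`. -/
def totalEnergy {d : ℕ} (Lg : Coord d → Coord d → ℝ) (ψ : Coord d → ℝ) (q v : Coord d) : ℝ :=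
  finslerEnergy Lg q v + ψ q

end

/-! The energy is a Lyapunov function. Homogeneity of `finslerEnergy` gives Euler's identity `⟪p, v⟫
= 2 Lₑ`, so `M a + ξ` does work exactly at the rate at which `Lₑ` changes. Bending does no work, and
neither do constraint forces where `v` is continuous: there `q` is differentiable from both sides
and every active `g i ∘ q` has a minimum. So `Lₑ + ψ` falls at least at the damping rate off a
countable set and can only jump downwards. `le_of_right_deriv_nonpos_off_countable` turns this into
a global inequality even if impacts accumulate; boundedness below yields integrability and the
limit.

Velocities die out (`tendsto_velocity`) by looking backwards in time. If `Lₑ` is at least `δ` at a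
time spent in a compact set, then, the energy having been no smaller before and `ψ` having changed
little, the speed was bounded below on a preceding interval of fixed length. The energy lost there
is bounded below, which contradicts convergence of the energy.

Accumulation points are KKT points (`mem_kktSet_of_mapClusterPt`) by testing the momentum. Near a
feasible point that is not KKT, linear independence supplies a `C¹` field `W` of descent directions
on which contact forces and impulses act nonnegatively (`exists_test_field`). With small velocity
all other terms except `-∇ψ` are small, so `⟪W(q), p⟫` must grow at a definite rate for a unit of
time, although it is itself small. No control of accelerations or multipliers is needed, and impacts
only help. The remaining claims are compactness and connectedness arguments about limit sets. -/

/-! ### Monotonicity with a countable exceptional set. -/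

/-- A right continuous function that only jumps downwards and has nonpositive right derivative
outside a countable set does not increase. -/
theorem le_of_right_deriv_nonpos_off_countable {Φ : ℝ → ℝ} {a b : ℝ} (hab : a ≤ b) {S : Set ℝ}
    (hS : S.Countable) (hr : ∀ t ∈ Ico a b, ContinuousWithinAt Φ (Ici t) t)
    (hl : ∀ t ∈ Ioc a b, ∃ l, Tendsto Φ (𝓝[<] t) (𝓝 l) ∧ Φ t ≤ l)
    (hd : ∀ t ∈ Ico a b, t ∉ S → ∃ Φ', Φ' ≤ 0 ∧ HasDerivWithinAt Φ Φ' (Ici t) t) :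
    Φ b ≤ Φ a := by
  have key : ∀ ε > 0, Φ b ≤ Φ a + ε * (b - a) + ε := by
    intro ε hε
    obtain ⟨w, hw0, hwsum⟩ := hS.exists_pos_hasSum_le hε
    obtain ⟨W, hwW, hWε⟩ := hwsum
    -- A barrier of total rise at most `ε`. Because of the strict inequality each exceptional time
    -- releases its weight just after itself, which leaves room for `Φ` to the right, where only
    -- right continuity is known.
    set σ : ℝ → ℝ := fun t => ∑' i : S, if (i : ℝ) < t then w i else 0 with hσ
    have hw0' : ∀ i : S, 0 < w i := fun i => hw0 i
    have hsm : ∀ t, Summable fun i : S => if (i : ℝ) < t then w i else 0 := by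
      intro t
      refine Summable.of_nonneg_of_le (fun i => ?_) (fun i => ?_) hwW.summable
      · split_ifs <;> simp [(hw0' i).le]
      · split_ifs <;> simp [(hw0' i).le]
    have hmono : ∀ s t, s ≤ t → σ s ≤ σ t := by
      intro s t hst
      refine (hsm s).tsum_le_tsum (fun i => ?_) (hsm t)
      by_cases h : (i : ℝ) < s
      · simp [h, h.trans_le hst]
      · simp only [h, if_false]
        split_ifs <;> simp [(hw0' i).le]
    have hσ0 : ∀ t, 0 ≤ σ t := fun t =>
      tsum_nonneg fun i => by split_ifs <;> simp [(hw0' i).le]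
    have hσε : ∀ t, σ t ≤ ε := by
      intro t
      refine le_trans ((hsm t).tsum_le_tsum (fun i => ?_) hwW.summable) (hwW.tsum_eq.trans_le hWε)
      split_ifs <;> simp [(hw0' i).le]
    have hjump : ∀ (s : S) (t : ℝ), (s : ℝ) < t → σ s + w s ≤ σ t := by
      intro s t hst
      have h1 : HasSum (fun i : S => if i = s then w s else 0) (w s) := hasSum_ite_eq s (w s)
      rw [← h1.tsum_eq, hσ]
      simp only
      rw [← (hsm s).tsum_add h1.summable]
      refine ((hsm s).add h1.summable).tsum_le_tsum (fun i => ?_) (hsm t)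
      by_cases h : i = s
      · subst h; simp [hst]
      · by_cases h' : (i : ℝ) < s
        · simp [h, h', h'.trans hst]
        · simp only [h, h', if_false, add_zero]
          split_ifs <;> simp [(hw0' i).le]
    set β : ℝ → ℝ := fun t => Φ a + ε * (t - a) + σ t with hβ
    have hβm : ∀ s t, s ≤ t → β s ≤ β t := by
      intro s t hst
      have := hmono s t hst
      simp only [hβ]
      nlinarith
    set A : Set ℝ := {t | t ∈ Icc a b ∧ ∀ s ∈ Icc a t, Φ s ≤ β s} with hA
    have haA : a ∈ A := by
      refine ⟨⟨le_rfl, hab⟩, fun s hs => ?_⟩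
      have : s = a := le_antisymm hs.2 hs.1
      subst this
      simp [hβ, hσ0]
    have hbdd : BddAbove A := ⟨b, fun t ht => ht.1.2⟩
    set c := sSup A with hc
    have hac : a ≤ c := le_csSup hbdd haA
    have hcb : c ≤ b := csSup_le ⟨a, haA⟩ fun t ht => ht.1.2
    have hlt : ∀ s, a ≤ s → s < c → Φ s ≤ β s := by
      intro s has hsc
      obtain ⟨t, htA, hst⟩ := exists_lt_of_lt_csSup ⟨a, haA⟩ hsc
      exact htA.2 s ⟨has, hst.le⟩
    -- The bound survives at the supremum: `Φ` lies below its left limit and `β` is monotone.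
    have hcβ : Φ c ≤ β c := by
      rcases hac.eq_or_lt with h | h
      · rw [← h]; exact haA.2 a ⟨le_rfl, le_rfl⟩
      · obtain ⟨l, hl1, hl2⟩ := hl c ⟨h, hcb⟩
        refine hl2.trans (le_of_tendsto hl1 ?_)
        filter_upwards [Ioo_mem_nhdsLT h] with s hs
        exact (hlt s hs.1.le hs.2).trans (hβm s c hs.2.le)
    have hle : ∀ s ∈ Icc a c, Φ s ≤ β s := by
      intro s hs
      rcases hs.2.eq_or_lt with h | h
      · rw [h]; exact hcβ
      · exact hlt s hs.1 h
    have hcb' : c = b := by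
      by_contra hne
      have hcb2 : c < b := lt_of_le_of_ne hcb hne
      have hev : ∀ᶠ t in 𝓝[>] c, Φ t ≤ β t := by
        by_cases hcS : c ∈ S
        · have h1 : Tendsto Φ (𝓝[>] c) (𝓝 (Φ c)) :=
            (hr c ⟨hac, hcb2⟩).mono_left (nhdsWithin_mono _ Ioi_subset_Ici_self)
          have h2 : Φ c < Φ c + w c := lt_add_of_pos_right _ (hw0 c)
          filter_upwards [h1.eventually_lt_const h2, self_mem_nhdsWithin] with t ht htc
          have h3 : σ c + w c ≤ σ t := hjump ⟨c, hcS⟩ t htc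
          have h4 : ε * (c - a) ≤ ε * (t - a) := by
            have : c < t := htc
            nlinarith
          simp only [hβ] at hcβ ⊢
          linarith
        · obtain ⟨Φ', h0, h1⟩ := hd c ⟨hac, hcb2⟩ hcS
          have h2 := (hasDerivWithinAt_iff_tendsto_slope' (by simp)).1 h1.Ioi_of_Ici
          filter_upwards [h2.eventually_lt_const (h0.trans_lt hε), self_mem_nhdsWithin] with t ht htc
          have htc' : c < t := htc
          rw [slope_def_field, div_lt_iff₀ (by linarith)] at ht
          have h3 := hmono c t htc'.le
          simp only [hβ] at hcβ ⊢
          nlinarith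
      obtain ⟨u, hu, hu2⟩ := mem_nhdsGT_iff_exists_Ioc_subset.1 hev
      have hu' : c < min u b := lt_min hu hcb2
      have : min u b ∈ A := by
        refine ⟨⟨hac.trans hu'.le, min_le_right _ _⟩, fun s hs => ?_⟩
        rcases le_or_gt s c with h | h
        · exact hle s ⟨hs.1, h⟩
        · exact hu2 ⟨h, hs.2.trans (min_le_left _ _)⟩
      exact absurd (le_csSup hbdd this) (not_le.2 hu')
    have := hcb' ▸ hcβ
    have h5 := hσε b
    simp only [hβ] at this
    linarith
  refine le_of_forall_pos_le_add fun δ hδ => ?_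
  have hpos : 0 < b - a + 1 := by linarith
  -- The slope term and the jumps together cost `ε * (b - a + 1)`.
  have := key (δ / (b - a + 1)) (by positivity)
  have h2 : δ / (b - a + 1) * (b - a) + δ / (b - a + 1) = δ := by field_simp
  linarith

/-! ### Curves with a right derivative. -/

section Travel

variable {E : Type*} [NormedAddCommGroup E] [NormedSpace ℝ E]

/-- A curve whose speed is at most `V` near `x` needs time to leave a ball around `x`. -/
theorem mem_closedBall_of_speed_le {q v : ℝ → E} {a b V ρ : ℝ} {x : E}
    (hq : ContinuousOn q (Icc a b)) (hv : ∀ t ∈ Ico a b, HasDerivWithinAt q (v t) (Ici t) t)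
    (hV : ∀ t ∈ Icc a b, q t ∈ Metric.closedBall x ρ → ‖v t‖ ≤ V)
    (hVρ : V * (b - a) < ρ / 2) {t₀ : ℝ} (ht₀ : t₀ ∈ Icc a b) (hx : dist (q t₀) x ≤ ρ / 2)
    {t : ℝ} (ht : t ∈ Icc a b) : q t ∈ Metric.closedBall x ρ := by
  have hρ : 0 ≤ ρ := by linarith [dist_nonneg (x := q t₀) (y := x)]
  have hV0 : 0 ≤ V :=
    (norm_nonneg _).trans (hV t₀ ht₀ (Metric.mem_closedBall.2 (hx.trans (by linarith))))
  rcases hρ.eq_or_lt with h0 | hρ0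
  · have := ht₀.1.trans ht₀.2
    exfalso
    nlinarith
  by_contra hcon
  have hcon' : ρ < dist (q t) x := by simpa using hcon
  have hD : ContinuousOn (fun s => dist (q s) x) (Icc a b) :=
    fun s hs => (hq s hs).dist tendsto_const_nhds
  have hspeed : ∀ s₁ s₂, s₁ ∈ Icc a b → s₂ ∈ Icc a b → s₁ ≤ s₂ →
      (∀ s ∈ Icc s₁ s₂, dist (q s) x ≤ ρ) → dist (q s₂) (q s₁) < ρ / 2 := by
    intro s₁ s₂ h₁ h₂ h12 h
    have := norm_image_sub_le_of_norm_deriv_right_le_segment (f := q) (f' := v) (a := s₁) (b := s₂)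
      (C := V) (hq.mono (Icc_subset_Icc h₁.1 h₂.2))
      (fun s hs => hv s ⟨h₁.1.trans hs.1, hs.2.trans_le h₂.2⟩)
      (fun s hs => hV s ⟨h₁.1.trans hs.1, hs.2.le.trans h₂.2⟩ (h s ⟨hs.1, hs.2.le⟩)) s₂ ⟨h12, le_rfl⟩
    rw [dist_eq_norm]
    refine this.trans_lt (lt_of_le_of_lt ?_ hVρ)
    have := h₁.1
    have := h₂.2
    gcongr
  rcases le_total t₀ t with h | h
  · have hsub : Icc t₀ t ⊆ Icc a b := Icc_subset_Icc ht₀.1 ht.2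
    have hcpt : IsCompact (Icc t₀ t ∩ (fun s => dist (q s) x) ⁻¹' Ici ρ) :=
      isCompact_Icc.of_isClosed_subset
        ((hD.mono hsub).preimage_isClosed_of_isClosed isClosed_Icc isClosed_Ici) inter_subset_left
    -- First time at distance `ρ` or more: until then the speed bound applies, and the distance
    -- covered is too short. The other case uses the last such time before `t₀`.
    obtain ⟨s, ⟨hs, hsρ⟩, hmin⟩ := hcpt.exists_isLeast ⟨t, ⟨h, le_rfl⟩, hcon'.le⟩
    have hlt : ∀ r ∈ Icc t₀ t, r < s → dist (q r) x < ρ := by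
      intro r hr hrs
      by_contra hc
      exact absurd (hmin ⟨hr, not_lt.1 hc⟩) (not_le.2 hrs)
    have hts : t₀ < s := by
      refine lt_of_le_of_ne hs.1 fun he => ?_
      have : ρ ≤ dist (q s) x := hsρ
      rw [← he] at this
      linarith
    have hsle : dist (q s) x ≤ ρ := by
      have h1 : Tendsto (fun s => dist (q s) x) (𝓝[Ioo t₀ s] s) (𝓝 (dist (q s) x)) :=
        (hD s (hsub hs)).mono_left (nhdsWithin_mono _
          (Ioo_subset_Icc_self.trans (Icc_subset_Icc ht₀.1 (hs.2.trans ht.2))))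
      have : (𝓝[Ioo t₀ s] s).NeBot := by rw [nhdsWithin_Ioo_eq_nhdsLT hts]; infer_instance
      refine le_of_tendsto h1 ?_
      filter_upwards [self_mem_nhdsWithin] with r hr
      exact (hlt r ⟨hr.1.le, hr.2.le.trans hs.2⟩ hr.2).le
    have h3 := hspeed t₀ s ht₀ (hsub hs) hs.1 (fun r hr => by
      rcases hr.2.eq_or_lt with h | h
      · rw [h]; exact hsle
      · exact (hlt r ⟨hr.1, hr.2.trans hs.2⟩ h).le)
    have h4 := dist_triangle (q s) (q t₀) x
    have : ρ ≤ dist (q s) x := hsρ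
    linarith
  · have hsub : Icc t t₀ ⊆ Icc a b := Icc_subset_Icc ht.1 ht₀.2
    have hcpt : IsCompact (Icc t t₀ ∩ (fun s => dist (q s) x) ⁻¹' Ici ρ) :=
      isCompact_Icc.of_isClosed_subset
        ((hD.mono hsub).preimage_isClosed_of_isClosed isClosed_Icc isClosed_Ici) inter_subset_left
    obtain ⟨s, ⟨hs, hsρ⟩, hmax⟩ := hcpt.exists_isGreatest ⟨t, ⟨le_rfl, h⟩, hcon'.le⟩
    have hlt : ∀ r ∈ Icc t t₀, s < r → dist (q r) x < ρ := by
      intro r hr hrs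
      by_contra hc
      exact absurd (hmax ⟨hr, not_lt.1 hc⟩) (not_le.2 hrs)
    have hts : s < t₀ := by
      refine lt_of_le_of_ne hs.2 fun he => ?_
      have : ρ ≤ dist (q s) x := hsρ
      rw [he] at this
      linarith
    have hsle : dist (q s) x ≤ ρ := by
      have h1 : Tendsto (fun s => dist (q s) x) (𝓝[Ioo s t₀] s) (𝓝 (dist (q s) x)) :=
        (hD s (hsub hs)).mono_left (nhdsWithin_mono _
          (Ioo_subset_Icc_self.trans (Icc_subset_Icc (ht.1.trans hs.1) ht₀.2)))
      have : (𝓝[Ioo s t₀] s).NeBot := by rw [nhdsWithin_Ioo_eq_nhdsGT hts]; infer_instance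
      refine le_of_tendsto h1 ?_
      filter_upwards [self_mem_nhdsWithin] with r hr
      exact (hlt r ⟨hs.1.trans hr.1.le, hr.2.le⟩ hr.1).le
    have h3 := hspeed s t₀ (hsub hs) ht₀ hs.2 (fun r hr => by
      rcases hr.1.eq_or_lt with h | h
      · rw [← h]; exact hsle
      · exact (hlt r ⟨hs.1.trans hr.1, hr.2⟩ h).le)
    have h4 := dist_triangle_left (q s) x (q t₀)
    have : ρ ≤ dist (q s) x := hsρ
    linarith

/-- Where the right derivative is continuous, it is a derivative. -/
theorem hasDerivAt_of_right_deriv {q v : ℝ → E} {a t : ℝ} (hat : a < t)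
    (hq : ContinuousOn q (Ici a)) (hv : ∀ s, a ≤ s → HasDerivWithinAt q (v s) (Ici s) s)
    (hvt : ContinuousAt v t) : HasDerivAt q (v t) t := by
  rw [← hasDerivWithinAt_univ, ← Iic_union_Ici (a := t)]
  refine HasDerivWithinAt.union ?_ (hv t hat.le)
  rw [hasDerivWithinAt_iff_isLittleO, Asymptotics.isLittleO_iff]
  intro ε hε
  obtain ⟨δ, hδ, hball⟩ := Metric.continuousAt_iff.1 hvt ε hε
  filter_upwards [Icc_mem_nhdsLE (max_lt hat (sub_lt_self t (half_pos hδ)))] with s hs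
  have h1 := (le_max_left _ _).trans hs.1
  have h2 : t - δ / 2 ≤ s := (le_max_right _ _).trans hs.1
  -- With the tangent line removed, the right derivative is `v r - v t`, which is small to the left
  -- of `t` as well.
  have h3 := norm_image_sub_le_of_norm_deriv_right_le_segment (f := fun r => q r - (r - t) • v t)
    (f' := fun r => v r - v t) (a := s) (b := t) (C := ε)
    ((hq.mono fun r hr => h1.trans hr.1).sub (by fun_prop))
    (fun r hr => by
      have := (hv r (h1.trans hr.1)).sub
        (((hasDerivWithinAt_id r (Ici r)).sub_const t).smul_const (v t))
      rw [one_smul] at this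
      exact this)
    (fun r hr => by
      rw [← dist_eq_norm]
      refine (hball ?_).le
      rw [Real.dist_eq, abs_lt]
      constructor <;> linarith [hr.1, hr.2]) t ⟨hs.2, le_rfl⟩
  rw [norm_sub_rev, Real.norm_eq_abs, abs_sub_comm, abs_of_nonneg (sub_nonneg.2 hs.2)]
  have h4 : (s - t) • v t - (q s - q t) = q t - (t - t) • v t - (q s - (s - t) • v t) := by
    rw [sub_self, zero_smul]
    abel
  rw [h4]
  exact h3

end Travel

/-! ### Positively homogeneous functions of the velocity, locally uniform in position. -/

section Homogeneous

variable {E G : Type*} [NormedAddCommGroup E] [NormedSpace ℝ E] [NormedAddCommGroup G]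
  [NormedSpace ℝ G] {Q : Set E} {φ : E → E → G} {n : ℕ}

theorem apply_zero_of_homogeneous (hn : n ≠ 0)
    (hom : ∀ q ∈ Q, ∀ v, ∀ α : ℝ, 0 ≤ α → φ q (α • v) = α ^ n • φ q v) {q : E} (hq : q ∈ Q) :
    φ q 0 = 0 := by
  have := hom q hq 0 0 le_rfl
  simpa [hn] using this

/-- Rescaling to unit velocity reduces the bound to compactness of `K` times the sphere. -/
theorem exists_norm_le_of_homogeneous [FiniteDimensional ℝ E] (hn : n ≠ 0)
    (hφ : ContinuousOn (fun z : E × E => φ z.1 z.2) (Q ×ˢ {0}ᶜ))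
    (hom : ∀ q ∈ Q, ∀ v, ∀ α : ℝ, 0 ≤ α → φ q (α • v) = α ^ n • φ q v) {K : Set E}
    (hK : IsCompact K) (hKQ : K ⊆ Q) : ∃ C, 0 < C ∧ ∀ q ∈ K, ∀ v, ‖φ q v‖ ≤ C * ‖v‖ ^ n := by
  have : ProperSpace E := FiniteDimensional.proper ℝ E
  obtain ⟨C, hC⟩ := (hK.prod (isCompact_sphere (0 : E) 1)).exists_bound_of_continuousOn
    (hφ.mono (prod_mono hKQ fun v hv => by
      have : ‖v‖ = 1 := by simpa using hv
      simp only [mem_compl_iff, mem_singleton_iff]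
      rintro rfl
      simp at this))
  refine ⟨max C 1, by positivity, fun q hq v => ?_⟩
  rcases eq_or_ne v 0 with rfl | hv
  · simp [apply_zero_of_homogeneous hn hom (hKQ hq), hn]
  · have h0 : ‖v‖ ≠ 0 := norm_ne_zero_iff.2 hv
    have h1 : v = ‖v‖ • (‖v‖⁻¹ • v) := by rw [smul_smul, mul_inv_cancel₀ h0, one_smul]
    have h2 : ‖φ q (‖v‖⁻¹ • v)‖ ≤ C := hC (q, ‖v‖⁻¹ • v) ⟨hq, by simp [norm_smul, h0]⟩
    conv_lhs => rw [h1]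
    rw [hom q (hKQ hq) _ _ (norm_nonneg v), norm_smul, norm_pow, norm_norm, mul_comm]
    gcongr
    exact h2.trans (le_max_left _ _)

/-- At zero velocity continuity is automatic, squeezed by `C * ‖v‖ ^ n` on a ball of positions. -/
theorem continuousOn_of_homogeneous [FiniteDimensional ℝ E] (hQ : IsOpen Q) (hn : n ≠ 0)
    (hφ : ContinuousOn (fun z : E × E => φ z.1 z.2) (Q ×ˢ {0}ᶜ))
    (hom : ∀ q ∈ Q, ∀ v, ∀ α : ℝ, 0 ≤ α → φ q (α • v) = α ^ n • φ q v) :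
    ContinuousOn (fun z : E × E => φ z.1 z.2) (Q ×ˢ univ) := by
  have : ProperSpace E := FiniteDimensional.proper ℝ E
  rintro ⟨q, v⟩ ⟨hq, -⟩
  refine ContinuousAt.continuousWithinAt ?_
  rcases eq_or_ne v 0 with rfl | hv
  · obtain ⟨ρ, hρ, hball⟩ := Metric.nhds_basis_closedBall.mem_iff.1 (hQ.mem_nhds hq)
    obtain ⟨C, hC, hbd⟩ :=
      exists_norm_le_of_homogeneous hn hφ hom (isCompact_closedBall q ρ) hball
    rw [ContinuousAt, apply_zero_of_homogeneous hn hom hq]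
    have h1 : Tendsto (fun z : E × E => C * ‖z.2‖ ^ n) (𝓝 (q, 0)) (𝓝 0) := by
      have : Continuous fun z : E × E => C * ‖z.2‖ ^ n := by fun_prop
      simpa [hn] using this.tendsto (q, 0)
    refine squeeze_zero_norm' ?_ h1
    have : ∀ᶠ z : E × E in 𝓝 (q, 0), z.1 ∈ Metric.closedBall q ρ :=
      continuous_fst.continuousAt.eventually_mem (Metric.closedBall_mem_nhds q hρ)
    filter_upwards [this] with z hz using hbd _ hz _
  · exact hφ.continuousAt ((hQ.prod isOpen_compl_singleton).mem_nhds ⟨hq, hv⟩)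

theorem exists_le_of_homogeneous [FiniteDimensional ℝ E] {φ : E → E → ℝ} (hn : n ≠ 0)
    (hφ : ContinuousOn (fun z : E × E => φ z.1 z.2) (Q ×ˢ {0}ᶜ))
    (hom : ∀ q ∈ Q, ∀ v, ∀ α : ℝ, 0 ≤ α → φ q (α • v) = α ^ n • φ q v)
    (hpos : ∀ q ∈ Q, ∀ v, v ≠ 0 → 0 < φ q v) {K : Set E}
    (hK : IsCompact K) (hKQ : K ⊆ Q) : ∃ m, 0 < m ∧ ∀ q ∈ K, ∀ v, m * ‖v‖ ^ n ≤ φ q v := by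
  have : ProperSpace E := FiniteDimensional.proper ℝ E
  have hne : ∀ v ∈ Metric.sphere (0 : E) 1, v ≠ 0 := by
    rintro v hv rfl
    simp at hv
  obtain ⟨m, hm, hle⟩ := (hK.prod (isCompact_sphere (0 : E) 1)).exists_forall_le'
    (hφ.mono (prod_mono hKQ hne)) (a := 0) (fun z hz => hpos _ (hKQ hz.1) _ (hne _ hz.2))
  refine ⟨m, hm, fun q hq v => ?_⟩
  rcases eq_or_ne v 0 with rfl | hv
  · simp [apply_zero_of_homogeneous hn hom (hKQ hq), hn]
  · have h0 : ‖v‖ ≠ 0 := norm_ne_zero_iff.2 hv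
    have h1 : v = ‖v‖ • (‖v‖⁻¹ • v) := by rw [smul_smul, mul_inv_cancel₀ h0, one_smul]
    have h2 : m ≤ φ q (‖v‖⁻¹ • v) := hle (q, ‖v‖⁻¹ • v) ⟨hq, by simp [norm_smul, h0]⟩
    conv_rhs => rw [h1]
    rw [hom q (hKQ hq) _ _ (norm_nonneg v), smul_eq_mul, mul_comm]
    gcongr

end Homogeneous

/-! ### Energy, momentum and damping of a Finsler structure. -/

section Finsler

variable {d : ℕ} {Q : Set (Coord d)} {Lg : Coord d → Coord d → ℝ}

theorem inner_gradient_eq_fderiv (f : Coord d → ℝ) (x u : Coord d) :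
    inner ℝ (gradient f x) u = fderiv ℝ f x u :=
  InnerProductSpace.toDual_symm_apply

/-- The Riesz representation as a linear map over `ℝ`. -/
noncomputable def rieszMap (d : ℕ) : (Coord d →L[ℝ] ℝ) →L[ℝ] Coord d :=
  LinearMap.toContinuousLinearMap
    { toFun := (InnerProductSpace.toDual ℝ (Coord d)).symm
      map_add' := map_add _
      map_smul' := fun c x => by simp }

theorem gradient_eq_rieszMap (f : Coord d → ℝ) (x : Coord d) :
    gradient f x = rieszMap d (fderiv ℝ f x) := rfl

theorem inner_rieszMap (l : Coord d →L[ℝ] ℝ) (u : Coord d) : inner ℝ (rieszMap d l) u = l u :=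
  InnerProductSpace.toDual_symm_apply


theorem finslerEnergy_nonneg (q v : Coord d) : 0 ≤ finslerEnergy Lg q v := by
  unfold finslerEnergy; positivity

theorem IsFinslerStructure.contDiffOn_energy (hL : IsFinslerStructure Q Lg) :
    ContDiffOn ℝ 2 (fun x : Coord d × Coord d => finslerEnergy Lg x.1 x.2) (Q ×ˢ {0}ᶜ) :=
  contDiffOn_const.mul (hL.contDiffOn.pow 2)

theorem IsFinslerStructure.energy_smul (hL : IsFinslerStructure Q Lg) : ∀ q ∈ Q, ∀ v, ∀ α : ℝ,
    0 ≤ α → finslerEnergy Lg q (α • v) = α ^ 2 • finslerEnergy Lg q v := by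
  intro q hq v α hα
  simp only [finslerEnergy, hL.homogeneous q hq v α hα, smul_eq_mul]
  ring

theorem IsFinslerStructure.energy_zero (hL : IsFinslerStructure Q Lg) {q : Coord d} (hq : q ∈ Q) :
    finslerEnergy Lg q 0 = 0 :=
  apply_zero_of_homogeneous two_ne_zero hL.energy_smul hq

theorem IsFinslerStructure.energy_pos (hL : IsFinslerStructure Q Lg) : ∀ q ∈ Q, ∀ v, v ≠ 0 →
    0 < finslerEnergy Lg q v := by
  intro q hq v hv
  have : Lg q v ≠ 0 := fun h => hv ((hL.eq_zero_iff q hq v).1 h)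
  unfold finslerEnergy
  positivity

/-- Differentiating `L(αv) = α² L(v)` in `v` gives `α p(αv) = α² p(v)`; cancel `α`. For `α = 0`, the
case `α = 2` at `v = 0` forces `p(0) = 0`. -/
theorem IsFinslerStructure.momentum_smul (hL : IsFinslerStructure Q Lg) : ∀ q ∈ Q, ∀ v, ∀ α : ℝ,
    0 ≤ α → momentum (finslerEnergy Lg) q (α • v) = α ^ 1 • momentum (finslerEnergy Lg) q v := by
  have key : ∀ q ∈ Q, ∀ v, ∀ α : ℝ, 0 < α →
      momentum (finslerEnergy Lg) q (α • v) = α • momentum (finslerEnergy Lg) q v := by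
    intro q hq v α hα
    have h1 : fderiv ℝ (fun w => finslerEnergy Lg q (α • w)) v =
        α • fderiv ℝ (fun w => finslerEnergy Lg q w) (α • v) :=
      fderiv_comp_smul α
    have h2 : (fun w => finslerEnergy Lg q (α • w)) = α ^ 2 • fun w => finslerEnergy Lg q w := by
      funext w
      simp [hL.energy_smul q hq w α hα.le]
    rw [h2, fderiv_const_smul_field, pow_two, mul_smul] at h1
    have h3 := smul_right_injective _ hα.ne' h1
    simp only [momentum, gradient_eq_rieszMap]
    rw [← h3, Pi.smul_apply, map_smul]
  intro q hq v α hα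
  rw [pow_one]
  rcases hα.eq_or_lt with rfl | h
  · have h2 := key q hq 0 2 two_pos
    rw [smul_zero, two_smul] at h2
    rw [zero_smul, zero_smul]
    simpa using h2
  · exact key q hq v α h

theorem IsFinslerStructure.momentum_zero (hL : IsFinslerStructure Q Lg) {q : Coord d}
    (hq : q ∈ Q) : momentum (finslerEnergy Lg) q 0 = 0 :=
  apply_zero_of_homogeneous one_ne_zero hL.momentum_smul hq

theorem IsFinslerStructure.positionGradient_smul (hQ : IsOpen Q) (hL : IsFinslerStructure Q Lg) :
    ∀ q ∈ Q, ∀ v, ∀ α : ℝ, 0 ≤ α → gradient (fun x => finslerEnergy Lg x (α • v)) q =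
      α ^ 2 • gradient (fun x => finslerEnergy Lg x v) q := by
  intro q hq v α hα
  have h1 : (fun x => finslerEnergy Lg x (α • v)) =ᶠ[𝓝 q]
      α ^ 2 • fun x => finslerEnergy Lg x v := by
    filter_upwards [hQ.mem_nhds hq] with x hx
    simp [hL.energy_smul x hx v α hα]
  simp only [gradient_eq_rieszMap]
  rw [h1.fderiv_eq, fderiv_const_smul_field, Pi.smul_apply, map_smul]

theorem IsFinslerStructure.hasFDerivAt_energy (hQ : IsOpen Q) (hL : IsFinslerStructure Q Lg)
    {q v : Coord d} (hq : q ∈ Q) (hv : v ≠ 0) :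
    HasFDerivAt (fun x : Coord d × Coord d => finslerEnergy Lg x.1 x.2)
      (fderiv ℝ (fun x : Coord d × Coord d => finslerEnergy Lg x.1 x.2) (q, v)) (q, v) :=
  ((hL.contDiffOn_energy.contDiffAt ((hQ.prod isOpen_compl_singleton).mem_nhds
    (show (q, v) ∈ Q ×ˢ {0}ᶜ from ⟨hq, hv⟩))).differentiableAt two_ne_zero).hasFDerivAt

theorem IsFinslerStructure.momentum_eq (hQ : IsOpen Q) (hL : IsFinslerStructure Q Lg)
    {q v : Coord d} (hq : q ∈ Q) (hv : v ≠ 0) : momentum (finslerEnergy Lg) q v =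
      rieszMap d ((fderiv ℝ (fun x : Coord d × Coord d => finslerEnergy Lg x.1 x.2) (q, v)).comp
        (ContinuousLinearMap.inr ℝ (Coord d) (Coord d))) := by
  rw [momentum, gradient_eq_rieszMap]
  congr 1
  exact ((hL.hasFDerivAt_energy hQ hq hv).comp v (hasFDerivAt_prodMk_right q v)).fderiv

theorem IsFinslerStructure.positionGradient_eq (hQ : IsOpen Q) (hL : IsFinslerStructure Q Lg)
    {q v : Coord d} (hq : q ∈ Q) (hv : v ≠ 0) : gradient (fun x => finslerEnergy Lg x v) q =
      rieszMap d ((fderiv ℝ (fun x : Coord d × Coord d => finslerEnergy Lg x.1 x.2) (q, v)).comp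
        (ContinuousLinearMap.inl ℝ (Coord d) (Coord d))) := by
  rw [gradient_eq_rieszMap]
  congr 1
  exact (HasFDerivAt.comp (f := fun x => (x, v)) q (hL.hasFDerivAt_energy hQ hq hv)
    (hasFDerivAt_prodMk_left q v)).fderiv

theorem IsFinslerStructure.contDiffOn_fderiv_energy (hQ : IsOpen Q)
    (hL : IsFinslerStructure Q Lg) : ContDiffOn ℝ 1
      (fderiv ℝ (fun x : Coord d × Coord d => finslerEnergy Lg x.1 x.2)) (Q ×ˢ {0}ᶜ) :=
  hL.contDiffOn_energy.fderiv_of_isOpen (hQ.prod isOpen_compl_singleton) (by norm_num)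

theorem IsFinslerStructure.contDiffOn_momentum (hQ : IsOpen Q) (hL : IsFinslerStructure Q Lg) :
    ContDiffOn ℝ 1 (fun x : Coord d × Coord d => momentum (finslerEnergy Lg) x.1 x.2)
      (Q ×ˢ {0}ᶜ) :=
  ((rieszMap d).contDiff.comp_contDiffOn
    ((hL.contDiffOn_fderiv_energy hQ).clm_comp contDiffOn_const)).congr
      fun _ hx => hL.momentum_eq hQ hx.1 hx.2

theorem IsFinslerStructure.continuousOn_positionGradient (hQ : IsOpen Q)
    (hL : IsFinslerStructure Q Lg) : ContinuousOn
      (fun x : Coord d × Coord d => gradient (fun y => finslerEnergy Lg y x.2) x.1)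
      (Q ×ˢ {0}ᶜ) :=
  ((rieszMap d).contDiff.comp_contDiffOn
    ((hL.contDiffOn_fderiv_energy hQ).clm_comp contDiffOn_const)).continuousOn.congr
      fun _ hx => hL.positionGradient_eq hQ hx.1 hx.2

theorem IsFinslerStructure.continuousOn_energy (hQ : IsOpen Q) (hL : IsFinslerStructure Q Lg) :
    ContinuousOn (fun x : Coord d × Coord d => finslerEnergy Lg x.1 x.2) (Q ×ˢ univ) :=
  continuousOn_of_homogeneous hQ two_ne_zero hL.contDiffOn_energy.continuousOn hL.energy_smul

theorem IsFinslerStructure.continuousOn_momentum (hQ : IsOpen Q) (hL : IsFinslerStructure Q Lg) :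
    ContinuousOn (fun x : Coord d × Coord d => momentum (finslerEnergy Lg) x.1 x.2)
      (Q ×ˢ univ) :=
  continuousOn_of_homogeneous hQ one_ne_zero (hL.contDiffOn_momentum hQ).continuousOn
    hL.momentum_smul

/-- Euler's identity: differentiate `α ↦ L(αv)` at `α = 1` by the chain rule and by homogeneity. -/
theorem IsFinslerStructure.inner_momentum_self (hQ : IsOpen Q) (hL : IsFinslerStructure Q Lg)
    {q : Coord d} (hq : q ∈ Q) (v : Coord d) :
    inner ℝ (momentum (finslerEnergy Lg) q v) v = 2 * finslerEnergy Lg q v := by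
  rcases eq_or_ne v 0 with rfl | hv
  · simp [hL.energy_zero hq]
  have h1 : HasDerivAt (fun α : ℝ => finslerEnergy Lg q (α • v))
      (inner ℝ (momentum (finslerEnergy Lg) q v) v) 1 := by
    rw [momentum, inner_gradient_eq_fderiv]
    have h2 : HasFDerivAt (fun w => finslerEnergy Lg q w)
        (fderiv ℝ (fun w => finslerEnergy Lg q w) v) ((1 : ℝ) • v) := by
      rw [one_smul]
      exact ((hL.hasFDerivAt_energy hQ hq hv).comp v
        (hasFDerivAt_prodMk_right q v)).differentiableAt.hasFDerivAt
    have h3 := h2.comp_hasDerivAt (1 : ℝ) ((hasDerivAt_id (1 : ℝ)).smul_const v)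
    rwa [one_smul] at h3
  have h4 : HasDerivAt (fun α : ℝ => α ^ 2 * finslerEnergy Lg q v)
      (2 * finslerEnergy Lg q v) 1 := by
    simpa using (hasDerivAt_pow 2 (1 : ℝ)).mul_const (finslerEnergy Lg q v)
  refine h1.unique (h4.congr_of_eventuallyEq ?_)
  filter_upwards [lt_mem_nhds (zero_lt_one : (0 : ℝ) < 1)] with α hα
  rw [hL.energy_smul q hq v α hα.le, smul_eq_mul]

/-- The energy is `O(‖v‖²)` locally uniformly in `q`. This gives the energy balance at instants of
rest, where no second derivative is available. -/
theorem IsFinslerStructure.hasFDerivAt_energy_zero (hQ : IsOpen Q) (hL : IsFinslerStructure Q Lg)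
    {q : Coord d} (hq : q ∈ Q) :
    HasFDerivAt (fun x : Coord d × Coord d => finslerEnergy Lg x.1 x.2)
      (0 : Coord d × Coord d →L[ℝ] ℝ) (q, 0) := by
  obtain ⟨ρ, hρ, hball⟩ := Metric.nhds_basis_closedBall.mem_iff.1 (hQ.mem_nhds hq)
  obtain ⟨C, hC, hbd⟩ := exists_norm_le_of_homogeneous two_ne_zero
    hL.contDiffOn_energy.continuousOn hL.energy_smul (isCompact_closedBall q ρ) hball
  refine HasFDerivAt.of_isLittleO ?_
  have h1 : (fun x : Coord d × Coord d => ‖x - (q, 0)‖ ^ 2) =o[𝓝 (q, 0)] fun x => x - (q, 0) := by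
    have h2 : (fun y : Coord d × Coord d => ‖y‖ ^ 2) =o[𝓝 0] fun y => y :=
      Asymptotics.isLittleO_norm_pow_id one_lt_two
    have h3 : Tendsto (fun x : Coord d × Coord d => x - (q, 0)) (𝓝 (q, 0)) (𝓝 0) := by
      rw [← sub_self (q, (0 : Coord d))]
      exact tendsto_id.sub tendsto_const_nhds
    exact h2.comp_tendsto h3
  refine Asymptotics.IsBigO.trans_isLittleO (Asymptotics.IsBigO.of_bound C ?_) h1
  have : ∀ᶠ z : Coord d × Coord d in 𝓝 (q, 0), z.1 ∈ Metric.closedBall q ρ :=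
    continuous_fst.continuousAt.eventually_mem (Metric.closedBall_mem_nhds q hρ)
  filter_upwards [this] with z hz
  have h4 : ‖z.2‖ ≤ ‖z - (q, 0)‖ := by
    have := norm_snd_le (z - (q, 0))
    simpa using this
  simp only [hL.energy_zero hq, sub_zero, _root_.zero_apply, norm_pow, norm_norm]
  refine (hbd _ hz _).trans ?_
  gcongr

/-- The dependence of `B` on `v` is not homogeneous, so compactness requires a speed limit `V`. -/
theorem IsDamping.exists_le_inner {B : Coord d → Coord d → Coord d →L[ℝ] Coord d}
    (hB : IsDamping Q B) {K : Set (Coord d)} (hK : IsCompact K) (hKQ : K ⊆ Q) (V : ℝ) :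
    ∃ b, 0 < b ∧ ∀ q ∈ K, ∀ v, ‖v‖ ≤ V → b * ‖v‖ ^ 2 ≤ inner ℝ v (B q v v) := by
  have hne : ∀ v ∈ Metric.sphere (0 : Coord d) 1, v ≠ 0 := by
    rintro v hv rfl
    simp at hv
  have hcont : ContinuousOn (fun z : (Coord d × Coord d) × Coord d =>
      (inner ℝ z.2 (B z.1.1 z.1.2 z.2) : ℝ))
      ((K ×ˢ Metric.closedBall 0 V) ×ˢ Metric.sphere 0 1) := by
    refine continuousOn_snd.inner (𝕜 := ℝ) (ContinuousOn.clm_apply ?_ continuousOn_snd)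
    exact hB.continuousOn.comp continuousOn_fst fun z hz => ⟨hKQ hz.1.1, mem_univ _⟩
  obtain ⟨b, hb, hle⟩ := ((hK.prod (isCompact_closedBall (0 : Coord d) V)).prod
    (isCompact_sphere (0 : Coord d) 1)).exists_forall_le' hcont (a := 0)
      (fun z hz => hB.posDef _ (hKQ hz.1.1) _ _ (hne _ hz.2))
  refine ⟨b, hb, fun q hq v hv => ?_⟩
  rcases eq_or_ne v 0 with rfl | h0
  · simp
  · have h0 : ‖v‖ ≠ 0 := norm_ne_zero_iff.2 h0
    have h1 : v = ‖v‖ • (‖v‖⁻¹ • v) := by rw [smul_smul, mul_inv_cancel₀ h0, one_smul]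
    have h2 := hle ((q, v), ‖v‖⁻¹ • v) ⟨⟨hq, by simpa using hv⟩, by simp [norm_smul, h0]⟩
    simp only [map_smul, inner_smul_left, inner_smul_right, map_inv₀, conj_trivial] at h2
    rw [← div_eq_inv_mul, ← div_eq_inv_mul, div_div, ← pow_two, le_div_iff₀ (by positivity)] at h2
    exact h2

theorem IsDamping.inner_nonneg {B : Coord d → Coord d → Coord d →L[ℝ] Coord d}
    (hB : IsDamping Q B) {q : Coord d} (hq : q ∈ Q) (v : Coord d) :
    0 ≤ inner ℝ v (B q v v) := by
  rcases eq_or_ne v 0 with rfl | h0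
  · simp
  · exact (hB.posDef q hq v v h0).le

end Finsler

/-! ### Dual vectors and extension to vector fields. -/

/-- Coordinates of a left inverse of the linear combination map, turned into vectors by Riesz. -/
theorem LinearIndependent.exists_dual_family {d : ℕ} {A : Type*} [Fintype A] [DecidableEq A]
    {n : A → Coord d} (hn : LinearIndependent ℝ n) :
    ∃ w : A → Coord d, ∀ a b, inner ℝ (w b) (n a) = if a = b then 1 else 0 := by
  obtain ⟨l, hl⟩ := (Fintype.linearCombination ℝ n).exists_leftInverse_of_injective
    (LinearMap.ker_eq_bot.2 (linearIndependent_iff_injective_fintypeLinearCombination.1 hn))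
  refine ⟨fun b => rieszMap d
    (LinearMap.toContinuousLinearMap ((LinearMap.proj b : (A → ℝ) →ₗ[ℝ] ℝ) ∘ₗ l)), fun a b => ?_⟩
  rw [inner_rieszMap]
  have h1 : l (n a) = Pi.single a 1 := by
    have := LinearMap.congr_fun hl (Pi.single a 1)
    rwa [LinearMap.comp_apply, Fintype.linearCombination_apply_single, one_smul] at this
  simp [h1, Pi.single_apply, eq_comm]

theorem ContDiffAt.matrix_det {E A : Type*} [NormedAddCommGroup E] [NormedSpace ℝ E] [Fintype A]
    [DecidableEq A] {M : E → Matrix A A ℝ} {x : E} {k : WithTop ℕ∞}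
    (hM : ∀ a b, ContDiffAt ℝ k (fun y => M y a b) x) : ContDiffAt ℝ k (fun y => (M y).det) x := by
  simp only [Matrix.det_apply]
  exact ContDiffAt.sum fun σ _ => (contDiffAt_prod fun a _ => hM _ _).const_smul _

/-- A vector with prescribed products with linearly independent covectors extends to a smooth
vector field with the same products. -/
theorem exists_contDiffAt_field {d : ℕ} {A : Type*} [Fintype A] {n : A → Coord d → Coord d}
    {x : Coord d} (hn : ∀ a, ContDiffAt ℝ 1 (n a) x) (hli : LinearIndependent ℝ fun a => n a x)
    (w : Coord d) : ∃ W : Coord d → Coord d, W x = w ∧ ContDiffAt ℝ 1 W x ∧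
      ∀ᶠ y in 𝓝 x, ∀ a, inner ℝ (W y) (n a y) = inner ℝ w (n a x) := by
  classical
  obtain ⟨e, he⟩ := hli.exists_dual_family
  set M : Coord d → Matrix A A ℝ := fun y a b => inner ℝ (e b) (n a y) with hM
  set z : Coord d → A → ℝ := fun y a => inner ℝ w (n a x) - inner ℝ w (n a y) with hz
  have hMx : M x = 1 := by
    ext a b
    simp only [hM, he, Matrix.one_apply]
  have hzx : z x = 0 := by ext a; simp [hz]
  have hMc : ∀ a b, ContDiffAt ℝ 1 (fun y => M y a b) x := fun a b =>
    contDiffAt_const.inner ℝ (hn a)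
  have hdet : ContDiffAt ℝ 1 (fun y => (M y).det) x := ContDiffAt.matrix_det hMc
  have hdet0 : (M x).det ≠ 0 := by simp [hMx]
  have hzc : ∀ a, ContDiffAt ℝ 1 (fun y => z y a) x := fun a =>
    contDiffAt_const.sub (contDiffAt_const.inner ℝ (hn a))
  -- Correct `w` along the dual vectors by solving `M y • coefficients = z y`. As `M x = 1`, the
  -- matrix stays invertible nearby, and Cramer's rule shows that the solution is `C¹`.
  refine ⟨fun y => w + ∑ b, ((M y).det⁻¹ * (M y).cramer (z y) b) • e b, ?_, ?_, ?_⟩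
  · simp [hzx]
  · refine contDiffAt_const.add (ContDiffAt.sum fun b _ => ContDiffAt.smul
      ((hdet.inv hdet0).mul ?_) contDiffAt_const)
    simp only [Matrix.cramer_apply]
    refine ContDiffAt.matrix_det fun a a' => ?_
    simp only [Matrix.updateCol_apply]
    split_ifs
    · exact hzc a
    · exact hMc a a'
  · filter_upwards [hdet.continuousAt.eventually_ne hdet0] with y hy a
    have h1 := congrFun (Matrix.mulVec_cramer (M y) (z y)) a
    simp only [Matrix.mulVec, dotProduct, Pi.smul_apply, smul_eq_mul] at h1
    rw [inner_add_left, sum_inner]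
    simp only [inner_smul_left, conj_trivial]
    have h2 : ∑ b, (M y).det⁻¹ * (M y).cramer (z y) b * inner ℝ (e b) (n a y) =
        (M y).det⁻¹ * ∑ b, M y a b * (M y).cramer (z y) b := by
      rw [Finset.mul_sum]
      refine Finset.sum_congr rfl fun b _ => ?_
      simp only [hM]
      ring
    rw [h2, h1, inv_mul_cancel_left₀ hy]
    simp [hz]

/-! ### Energy balance along a motion. -/

section Motion

variable {d : ℕ} {ι κ : Type*} [Fintype ι] [Fintype κ] {Q : Set (Coord d)}
  {Lg : Coord d → Coord d → ℝ} {f : Coord d → Coord d → Coord d} {c : ι → Coord d → ℝ}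
  {g : κ → Coord d → ℝ} {ψ : Coord d → ℝ} {B : Coord d → Coord d → Coord d →L[ℝ] Coord d}
  {β : ℝ} {q v : ℝ → Coord d}

theorem inner_constraintTerm (x u : Coord d) (lam : ι → ℝ) (η : κ → ℝ) :
    inner ℝ (constraintTerm c g x lam η) u =
      ∑ j, lam j * inner ℝ (gradient (c j) x) u + ∑ i, η i * inner ℝ (gradient (g i) x) u := by
  simp [constraintTerm, inner_add_left, sum_inner, inner_smul_left]

theorem hasDerivWithinAt_comp_gradient {φ : Coord d → ℝ} {a : Coord d} {s : Set ℝ} {t : ℝ}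
    (hφ : DifferentiableAt ℝ φ (q t)) (hq : HasDerivWithinAt q a s t) :
    HasDerivWithinAt (fun r => φ (q r)) (inner ℝ (gradient φ (q t)) a) s t := by
  rw [inner_gradient_eq_fderiv]
  exact hφ.hasFDerivAt.comp_hasDerivWithinAt t hq

theorem IsFinslerStructure.hasDerivWithinAt_momentum (hQ : IsOpen Q)
    (hL : IsFinslerStructure Q Lg) {a : Coord d} {s : Set ℝ} {t : ℝ} (hqt : q t ∈ Q)
    (hvt : v t ≠ 0) (hq : HasDerivWithinAt q (v t) s t) (hv : HasDerivWithinAt v a s t) :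
    HasDerivWithinAt (fun r => momentum (finslerEnergy Lg) (q r) (v r))
      (mass (finslerEnergy Lg) (q t) (v t) a +
        fderiv ℝ (fun x => momentum (finslerEnergy Lg) x (v t)) (q t) (v t)) s t := by
  have h1 := (((hL.contDiffOn_momentum hQ).contDiffAt ((hQ.prod isOpen_compl_singleton).mem_nhds
    (show (q t, v t) ∈ Q ×ˢ {0}ᶜ from ⟨hqt, hvt⟩))).differentiableAt one_ne_zero).hasFDerivAt
  have h2 := h1.comp_hasDerivWithinAt t (hq.prodMk hv)
  have h3 := (h1.comp (v t) (hasFDerivAt_prodMk_right (q t) (v t))).fderiv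
  have h4 := (HasFDerivAt.comp (f := fun x => (x, v t)) (q t) h1
    (hasFDerivAt_prodMk_left (q t) (v t))).fderiv
  have h5 : mass (finslerEnergy Lg) (q t) (v t) a = _ := DFunLike.congr_fun h3 a
  have h6 : fderiv ℝ (fun x => momentum (finslerEnergy Lg) x (v t)) (q t) (v t) = _ :=
    DFunLike.congr_fun h4 (v t)
  rw [h5, h6]
  simp only [ContinuousLinearMap.comp_apply, ContinuousLinearMap.inr_apply,
    ContinuousLinearMap.inl_apply]
  rw [← map_add, Prod.mk_add_mk, zero_add, add_zero]
  exact h2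

/-- Two expressions for the derivative of `L`: the chain rule gives `⟪∂_q L, v⟫ + ⟪p, a⟫`, and `L =
½⟪p, v⟫` gives `½(⟪p', v⟫ + ⟪p, a⟫)`. Eliminating `⟪p, a⟫` leaves `⟪p' - ∂_q L, v⟫`. -/
theorem IsFinslerStructure.hasDerivWithinAt_energy (hQ : IsOpen Q)
    (hL : IsFinslerStructure Q Lg) {a : Coord d} {t : ℝ} (hqt : q t ∈ Q)
    (hvt : v t ≠ 0) (hq : HasDerivWithinAt q (v t) (Ici t) t)
    (hv : HasDerivWithinAt v a (Ici t) t) :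
    HasDerivWithinAt (fun r => finslerEnergy Lg (q r) (v r))
      (inner ℝ (mass (finslerEnergy Lg) (q t) (v t) a +
        geomTerm (finslerEnergy Lg) (q t) (v t)) (v t)) (Ici t) t := by
  have h1 := hL.hasFDerivAt_energy hQ hqt hvt
  have h2 := h1.comp_hasDerivWithinAt t (hq.prodMk hv)
  have h3 : fderiv ℝ (fun x : Coord d × Coord d => finslerEnergy Lg x.1 x.2) (q t, v t) (v t, a) =
      inner ℝ (gradient (fun x => finslerEnergy Lg x (v t)) (q t)) (v t) +
        inner ℝ (momentum (finslerEnergy Lg) (q t) (v t)) a := by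
    rw [hL.positionGradient_eq hQ hqt hvt, hL.momentum_eq hQ hqt hvt, inner_rieszMap,
      inner_rieszMap]
    simp only [ContinuousLinearMap.comp_apply, ContinuousLinearMap.inr_apply,
      ContinuousLinearMap.inl_apply]
    rw [← map_add, Prod.mk_add_mk, zero_add, add_zero]
  rw [h3] at h2
  have h4 := ((hL.hasDerivWithinAt_momentum hQ hqt hvt hq hv).inner ℝ hv).const_mul (1 / 2 : ℝ)
  have hev : ∀ᶠ r in 𝓝[Ici t] t, q r ∈ Q := hq.continuousWithinAt.eventually_mem (hQ.mem_nhds hqt)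
  have h5 : HasDerivWithinAt (fun r => finslerEnergy Lg (q r) (v r)) _ (Ici t) t :=
    h4.congr_of_eventuallyEq (by
      filter_upwards [hev] with r hr
      rw [hL.inner_momentum_self hQ hr]
      ring) (by
      rw [hL.inner_momentum_self hQ hqt]
      ring)
  have h6 := (uniqueDiffWithinAt_Ici t).eq_deriv _ h2 h5
  rw [inner_add_left] at h6
  convert h5 using 1
  simp only [geomTerm, inner_add_left, inner_sub_left]
  linarith

namespace IsMotion

theorem mem (hm : IsMotion Q Lg f ψ B c g β q v) {t : ℝ} (ht : 0 ≤ t) : q t ∈ Q :=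
  (hm.feasible t ht).1

theorem continuousAt (hm : IsMotion Q Lg f ψ B c g β q v) {t : ℝ} (ht : 0 < t) :
    ContinuousAt q t :=
  hm.continuousOn.continuousAt (Ici_mem_nhds ht)

/-- Continuity of `v` makes `q` differentiable from both sides; `c j ∘ q` is constant and an active
`g i ∘ q` has an interior minimum, so their derivatives vanish. -/
theorem inner_constraintTerm_velocity (hQ : IsOpen Q) (hm : IsMotion Q Lg f ψ B c g β q v)
    (hc : ∀ j, ContDiffOn ℝ 2 (c j) Q) (hg : ∀ i, ContDiffOn ℝ 2 (g i) Q) {t : ℝ} (ht : 0 < t)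
    (hv : ContinuousAt v t) {lam : ι → ℝ} {η : κ → ℝ} (hη : Complementary g (q t) η) :
    inner ℝ (constraintTerm c g (q t) lam η) (v t) = 0 := by
  have hq := hasDerivAt_of_right_deriv ht hm.continuousOn hm.velocity hv
  have hQt := hQ.mem_nhds (hm.mem ht.le)
  rw [inner_constraintTerm]
  have h1 : ∀ j, inner ℝ (gradient (c j) (q t)) (v t) = 0 := by
    intro j
    have h2 := hasDerivWithinAt_comp_gradient
      (((hc j).contDiffAt hQt).differentiableAt two_ne_zero) (hq.hasDerivWithinAt (s := univ))
    rw [hasDerivWithinAt_univ] at h2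
    refine (h2.congr_of_eventuallyEq (f₁ := fun _ => 0) ?_).unique (hasDerivAt_const t 0)
    filter_upwards [Ici_mem_nhds ht] with r hr
    exact ((hm.feasible r hr).2.1 j).symm
  have h2 : ∀ i, η i * inner ℝ (gradient (g i) (q t)) (v t) = 0 := by
    intro i
    rcases mul_eq_zero.1 (hη i).2 with h | h
    · rw [h, zero_mul]
    · have h2 := hasDerivWithinAt_comp_gradient
        (((hg i).contDiffAt hQt).differentiableAt two_ne_zero) (hq.hasDerivWithinAt (s := univ))
      rw [hasDerivWithinAt_univ] at h2
      have h3 : IsLocalMin (fun r => g i (q r)) t := by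
        filter_upwards [Ici_mem_nhds ht] with r hr
        rw [h]
        exact (hm.feasible r hr).2.2 i
      rw [h3.hasDerivAt_eq_zero h2, mul_zero]
  rw [Finset.sum_eq_zero fun j _ => by rw [h1, mul_zero], Finset.sum_eq_zero fun i _ => h2 i,
    add_zero]

/-- Energy balance between impacts. -/
theorem exists_hasDerivWithinAt_totalEnergy (hQ : IsOpen Q) (hL : IsFinslerStructure Q Lg)
    (hf : IsBendingTerm Q f) (hc : ∀ j, ContDiffOn ℝ 2 (c j) Q)
    (hg : ∀ i, ContDiffOn ℝ 2 (g i) Q) (hψ : ContDiffOn ℝ 1 ψ Q)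
    (hm : IsMotion Q Lg f ψ B c g β q v) {t : ℝ} (ht : 0 < t) {a : Coord d}
    (hv : HasDerivAt v a t) (heq : EquationOfMotion Lg f ψ B c g β (q t) (v t) a) :
    ∃ h ≤ -inner ℝ (v t) (B (q t) (v t) (v t)),
      HasDerivWithinAt (fun r => totalEnergy Lg ψ (q r) (v r)) h (Ici t) t := by
  have hqt := hm.mem ht.le
  have hq := hm.velocity t ht.le
  have hψ' := hasDerivWithinAt_comp_gradient
    ((hψ.contDiffAt (hQ.mem_nhds hqt)).differentiableAt one_ne_zero) hq
  by_cases h0 : v t = 0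
  · refine ⟨0, by simp [h0], ?_⟩
    have h1 := hL.hasFDerivAt_energy_zero hQ hqt
    rw [← h0] at h1
    have h2 := (h1.comp_hasDerivWithinAt t (hq.prodMk hv.hasDerivWithinAt)).add hψ'
    rw [h0, inner_zero_right, _root_.zero_apply, add_zero] at h2
    exact h2
  · obtain ⟨lam, η, r, hη, -, hr, -, he⟩ := heq
    have h1 := hm.inner_constraintTerm_velocity hQ hc hg ht hv.continuousAt (lam := lam) hη
    refine ⟨_, ?_, (hL.hasDerivWithinAt_energy hQ hqt h0 hq hv.hasDerivWithinAt).add hψ'⟩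
    have h2 := congrArg (fun x => inner ℝ x (v t)) he
    simp only [inner_add_left, inner_sub_left, inner_neg_left, h1] at h2
    have h3 := hf.zero_work (q t) hqt (v t)
    have h4 := real_inner_comm (v t) r
    have h5 := real_inner_comm (v t) (f (q t) (v t))
    have h6 := real_inner_comm (v t) (B (q t) (v t) (v t))
    rw [inner_add_left]
    linarith

theorem exists_countable (hm : IsMotion Q Lg f ψ B c g β q v) : ∃ S : Set ℝ, S.Countable ∧
    ∀ t, 0 ≤ t → t ∉ S → 0 < t ∧
      ∃ a, HasDerivAt v a t ∧ EquationOfMotion Lg f ψ B c g β (q t) (v t) a := by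
  obtain ⟨S, hS, h⟩ := hm.equation
  refine ⟨insert 0 S, hS.insert 0, fun t ht htS => ?_⟩
  rw [mem_insert_iff, not_or] at htS
  have h0 : 0 < t := lt_of_le_of_ne ht (Ne.symm htS.1)
  exact ⟨h0, h t h0 htS.2⟩

theorem continuousWithinAt_comp {G : Type*} [TopologicalSpace G] (hQ : IsOpen Q)
    (hm : IsMotion Q Lg f ψ B c g β q v) {φ : Coord d × Coord d → G}
    (hφ : ContinuousOn φ (Q ×ˢ univ)) {t : ℝ} (ht : 0 ≤ t) :
    ContinuousWithinAt (fun r => φ (q r, v r)) (Ici t) t :=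
  (hφ.continuousAt ((hQ.prod isOpen_univ).mem_nhds
    (show (q t, v t) ∈ Q ×ˢ univ from ⟨hm.mem ht, mem_univ _⟩))).comp_continuousWithinAt
    (f := fun r => (q r, v r))
    ((hm.velocity t ht).continuousWithinAt.prodMk (hm.right_continuous t ht))

theorem tendsto_comp {G : Type*} [TopologicalSpace G] (hQ : IsOpen Q)
    (hm : IsMotion Q Lg f ψ B c g β q v) {φ : Coord d × Coord d → G}
    (hφ : ContinuousOn φ (Q ×ˢ univ)) {t : ℝ} (ht : 0 < t) {w : Coord d}
    (hw : Tendsto v (𝓝[<] t) (𝓝 w)) :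
    Tendsto (fun r => φ (q r, v r)) (𝓝[<] t) (𝓝 (φ (q t, w))) :=
  (hφ.continuousAt ((hQ.prod isOpen_univ).mem_nhds
    (show (q t, w) ∈ Q ×ˢ univ from ⟨hm.mem ht.le, mem_univ _⟩))).tendsto.comp
    (((hm.continuousAt ht).tendsto.mono_left nhdsWithin_le_nhds).prodMk_nhds hw)

theorem continuousOn_totalEnergy (hQ : IsOpen Q) (hL : IsFinslerStructure Q Lg)
    (hψ : ContDiffOn ℝ 1 ψ Q) :
    ContinuousOn (fun x : Coord d × Coord d => totalEnergy Lg ψ x.1 x.2) (Q ×ˢ univ) :=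
  (hL.continuousOn_energy hQ).add (hψ.continuousOn.comp continuousOn_fst fun _ h => h.1)

theorem exists_leftLim_totalEnergy (hQ : IsOpen Q) (hL : IsFinslerStructure Q Lg)
    (hψ : ContDiffOn ℝ 1 ψ Q) (hm : IsMotion Q Lg f ψ B c g β q v) {t : ℝ} (ht : 0 < t) :
    ∃ l, Tendsto (fun r => totalEnergy Lg ψ (q r) (v r)) (𝓝[<] t) (𝓝 l) ∧
      totalEnergy Lg ψ (q t) (v t) ≤ l := by
  obtain ⟨w, hw, -, hle⟩ := hm.impact t ht
  exact ⟨_, hm.tendsto_comp hQ (continuousOn_totalEnergy hQ hL hψ) ht hw,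
    add_le_add_left hle _⟩

theorem totalEnergy_le (hQ : IsOpen Q) (hL : IsFinslerStructure Q Lg)
    (hf : IsBendingTerm Q f) (hc : ∀ j, ContDiffOn ℝ 2 (c j) Q)
    (hg : ∀ i, ContDiffOn ℝ 2 (g i) Q) (hψ : ContDiffOn ℝ 1 ψ Q) (hB : IsDamping Q B)
    (hm : IsMotion Q Lg f ψ B c g β q v) {s t : ℝ} (hs : 0 ≤ s) (hst : s ≤ t) :
    totalEnergy Lg ψ (q t) (v t) ≤ totalEnergy Lg ψ (q s) (v s) := by
  obtain ⟨S, hS, h⟩ := hm.exists_countable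
  refine le_of_right_deriv_nonpos_off_countable
    (Φ := fun r => totalEnergy Lg ψ (q r) (v r)) hst hS
    (fun r hr => hm.continuousWithinAt_comp hQ (continuousOn_totalEnergy hQ hL hψ)
      (hs.trans hr.1))
    (fun r hr => hm.exists_leftLim_totalEnergy hQ hL hψ (hs.trans_lt hr.1))
    (fun r hr hrS => ?_)
  obtain ⟨hr0, a, ha, he⟩ := h r (hs.trans hr.1) hrS
  obtain ⟨e, he1, he2⟩ :=
    hm.exists_hasDerivWithinAt_totalEnergy hQ hL hf hc hg hψ hr0 ha he
  exact ⟨e, he1.trans (neg_nonpos.2 (hB.inner_nonneg (hm.mem hr0.le) _)), he2⟩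

/-- Kinetic energy is at most the initial energy minus the lower bound of `ψ`, and on `K` it
dominates a multiple of `‖v‖²`. -/
theorem exists_speed_le (hQ : IsOpen Q) (hL : IsFinslerStructure Q Lg)
    (hf : IsBendingTerm Q f) (hc : ∀ j, ContDiffOn ℝ 2 (c j) Q)
    (hg : ∀ i, ContDiffOn ℝ 2 (g i) Q) (hψ : ContDiffOn ℝ 1 ψ Q)
    (hψb : BddBelow (ψ '' feasibleSet Q c g)) (hB : IsDamping Q B)
    (hm : IsMotion Q Lg f ψ B c g β q v) {K : Set (Coord d)} (hK : IsCompact K) (hKQ : K ⊆ Q) :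
    ∃ V, 0 < V ∧ ∀ t, 0 ≤ t → q t ∈ K → ‖v t‖ ≤ V := by
  obtain ⟨m, hm0, hle⟩ := exists_le_of_homogeneous two_ne_zero
    hL.contDiffOn_energy.continuousOn hL.energy_smul hL.energy_pos hK hKQ
  obtain ⟨p, hp⟩ := hψb
  set A := (totalEnergy Lg ψ (q 0) (v 0) - p) / m with hA
  refine ⟨√(max A 0) + 1, by positivity, fun t ht htK => ?_⟩
  have h1 := hm.totalEnergy_le hQ hL hf hc hg hψ hB le_rfl ht
  have h2 : p ≤ ψ (q t) := hp (mem_image_of_mem ψ (hm.feasible t ht))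
  have h3 := hle (q t) htK (v t)
  have h4 : ‖v t‖ ^ 2 ≤ A := by
    rw [hA, le_div_iff₀ hm0]
    unfold totalEnergy at h1 ⊢
    linarith
  have := Real.le_sqrt_of_sq_le (h4.trans (le_max_left A 0))
  linarith

/-- The integrand is continuous off a countable, hence null, set. -/
theorem aestronglyMeasurable_damping (hQ : IsOpen Q) (hB : IsDamping Q B)
    (hm : IsMotion Q Lg f ψ B c g β q v) :
    AEStronglyMeasurable (fun t => inner ℝ (v t) (B (q t) (v t) (v t)))
      (volume.restrict (Ioi 0)) := by
  obtain ⟨S, hS, h⟩ := hm.exists_countable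
  have h1 : ContinuousOn (fun t => inner ℝ (v t) (B (q t) (v t) (v t))) (Ioi 0 \ S) := by
    rintro t ⟨ht, htS⟩
    obtain ⟨-, a, ha, -⟩ := h t (le_of_lt ht) htS
    have hv := ha.continuousAt
    refine ContinuousAt.continuousWithinAt (hv.inner (𝕜 := ℝ) (ContinuousAt.clm_apply ?_ hv))
    exact (hB.continuousOn.continuousAt ((hQ.prod isOpen_univ).mem_nhds
      (show (q t, v t) ∈ Q ×ˢ univ from ⟨hm.mem (le_of_lt ht), mem_univ _⟩))).comp
      (f := fun r => (q r, v r)) ((hm.continuousAt ht).prodMk hv)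
  have h2 := h1.aestronglyMeasurable (μ := volume) (measurableSet_Ioi.diff hS.measurableSet)
  rwa [Measure.restrict_congr_set (sdiff_null_ae_eq_self (hS.measure_zero volume))] at h2

theorem intervalIntegrable_damping (hQ : IsOpen Q) (hL : IsFinslerStructure Q Lg)
    (hf : IsBendingTerm Q f) (hc : ∀ j, ContDiffOn ℝ 2 (c j) Q)
    (hg : ∀ i, ContDiffOn ℝ 2 (g i) Q) (hψ : ContDiffOn ℝ 1 ψ Q)
    (hψb : BddBelow (ψ '' feasibleSet Q c g)) (hB : IsDamping Q B)
    (hm : IsMotion Q Lg f ψ B c g β q v) {s t : ℝ} (hs : 0 ≤ s) (hst : s ≤ t) :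
    IntervalIntegrable (fun t => inner ℝ (v t) (B (q t) (v t) (v t))) volume s t := by
  obtain ⟨V, hV, hVb⟩ := hm.exists_speed_le hQ hL hf hc hg hψ hψb hB
    (isCompact_Icc.image_of_continuousOn
      (hm.continuousOn.mono (Icc_subset_Ici_self : Icc 0 t ⊆ Ici 0)))
    (image_subset_iff.2 fun r hr => hm.mem hr.1)
  obtain ⟨b, hb⟩ := hB.bounded
  rw [intervalIntegrable_iff_integrableOn_Ioc_of_le hst]
  refine Integrable.of_bound ((hm.aestronglyMeasurable_damping hQ hB).mono_set
    (show Ioc s t ⊆ Ioi 0 from fun r hr => hs.trans_lt hr.1)) (V * (b * V)) ?_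
  rw [ae_restrict_iff' measurableSet_Ioc]
  refine ae_of_all _ fun r hr => ?_
  have hr0 : 0 ≤ r := hs.trans hr.1.le
  have h1 := hVb r hr0 (mem_image_of_mem q ⟨hr0, hr.2⟩)
  have h2 := hb (q r) (hm.mem hr0) (v r)
  refine (norm_inner_le_norm _ _).trans ?_
  have h3 := (B (q r) (v r)).le_opNorm (v r)
  have h4 : ‖B (q r) (v r) (v r)‖ ≤ b * V := h3.trans (by gcongr; exact (norm_nonneg _).trans h2)
  gcongr

/-- Energy plus accumulated damping satisfies the monotonicity criterion: off the exceptional set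
`v` is continuous, so the integral is differentiable there. -/
theorem totalEnergy_le_sub_integral (hQ : IsOpen Q) (hL : IsFinslerStructure Q Lg)
    (hf : IsBendingTerm Q f) (hc : ∀ j, ContDiffOn ℝ 2 (c j) Q)
    (hg : ∀ i, ContDiffOn ℝ 2 (g i) Q) (hψ : ContDiffOn ℝ 1 ψ Q)
    (hψb : BddBelow (ψ '' feasibleSet Q c g)) (hB : IsDamping Q B)
    (hm : IsMotion Q Lg f ψ B c g β q v) {s t : ℝ} (hs : 0 ≤ s) (hst : s ≤ t) :
    totalEnergy Lg ψ (q t) (v t) ≤ totalEnergy Lg ψ (q s) (v s) -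
      ∫ r in s..t, inner ℝ (v r) (B (q r) (v r) (v r)) := by
  obtain ⟨S, hS, h⟩ := hm.exists_countable
  set k : ℝ → ℝ := fun r => inner ℝ (v r) (B (q r) (v r) (v r)) with hk
  have hint : ∀ r, s ≤ r → IntervalIntegrable k volume s r := fun r hr =>
    hm.intervalIntegrable_damping hQ hL hf hc hg hψ hψb hB hs hr
  have hcont : ContinuousOn (fun r => ∫ x in s..r, k x) (Icc s (t + 1)) := by
    have := intervalIntegral.continuousOn_primitive_interval' (hint (t + 1) (by linarith))
      left_mem_uIcc
    rwa [uIcc_of_le (by linarith)] at this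
  have key := le_of_right_deriv_nonpos_off_countable
    (Φ := fun r => totalEnergy Lg ψ (q r) (v r) + ∫ x in s..r, k x) hst hS
    (fun r hr => (hm.continuousWithinAt_comp hQ (continuousOn_totalEnergy hQ hL hψ)
      (hs.trans hr.1)).add ((hcont r ⟨hr.1, by linarith [hr.2]⟩).mono_of_mem_nhdsWithin
        (mem_of_superset (Icc_mem_nhdsGE (show r < t + 1 by linarith [hr.2]))
          (Icc_subset_Icc_left hr.1))))
    (fun r hr => by
      obtain ⟨l, hl, hle⟩ := hm.exists_leftLim_totalEnergy hQ hL hψ (hs.trans_lt hr.1)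
      refine ⟨_, hl.add (((hcont r ⟨hr.1.le, by linarith [hr.2]⟩).mono_of_mem_nhdsWithin
        (show Icc s (t + 1) ∈ 𝓝[<] r from mem_of_superset (Icc_mem_nhdsLT hr.1)
          (Icc_subset_Icc_right (show r ≤ t + 1 by linarith [hr.2])))).tendsto), ?_⟩
      simpa using hle)
    (fun r hr hrS => by
      obtain ⟨hr0, a, ha, he⟩ := h r (hs.trans hr.1) hrS
      obtain ⟨e, he1, he2⟩ :=
        hm.exists_hasDerivWithinAt_totalEnergy hQ hL hf hc hg hψ hr0 ha he
      have hv := ha.continuousAt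
      have hkc : ContinuousAt k r := by
        refine hv.inner (𝕜 := ℝ) (ContinuousAt.clm_apply ?_ hv)
        exact (hB.continuousOn.continuousAt ((hQ.prod isOpen_univ).mem_nhds
          (show (q r, v r) ∈ Q ×ˢ univ from ⟨hm.mem hr0.le, mem_univ _⟩))).comp
          (f := fun r => (q r, v r)) ((hm.continuousAt hr0).prodMk hv)
      have h3 := intervalIntegral.integral_hasDerivAt_right (hint r hr.1)
        ⟨Ioi 0, Ioi_mem_nhds hr0, hm.aestronglyMeasurable_damping hQ hB⟩ hkc
      refine ⟨e + k r, ?_, he2.add h3.hasDerivWithinAt⟩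
      simp only [hk]
      linarith)
  simp only [intervalIntegral.integral_same, add_zero] at key
  linarith

theorem integrableOn_damping (hQ : IsOpen Q) (hL : IsFinslerStructure Q Lg)
    (hf : IsBendingTerm Q f) (hc : ∀ j, ContDiffOn ℝ 2 (c j) Q)
    (hg : ∀ i, ContDiffOn ℝ 2 (g i) Q) (hψ : ContDiffOn ℝ 1 ψ Q)
    (hψb : BddBelow (ψ '' feasibleSet Q c g)) (hB : IsDamping Q B)
    (hm : IsMotion Q Lg f ψ B c g β q v) :
    IntegrableOn (fun t => inner ℝ (v t) (B (q t) (v t) (v t))) (Ici 0) := by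
  rw [integrableOn_Ici_iff_integrableOn_Ioi]
  obtain ⟨p, hp⟩ := hψb
  refine integrableOn_Ioi_of_intervalIntegral_norm_bounded (ι := ℝ) (l := atTop) (b := id)
    (totalEnergy Lg ψ (q 0) (v 0) - p) 0 (fun T => ?_) tendsto_id ?_
  · rcases le_total 0 T with hT | hT
    · exact (intervalIntegrable_iff_integrableOn_Ioc_of_le hT).1
        (hm.intervalIntegrable_damping hQ hL hf hc hg hψ ⟨p, hp⟩ hB le_rfl hT)
    · simp [hT]
  · filter_upwards [eventually_ge_atTop 0] with T hT
    have h1 := hm.totalEnergy_le_sub_integral hQ hL hf hc hg hψ ⟨p, hp⟩ hB le_rfl hT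
    have h2 : p ≤ ψ (q T) := hp (mem_image_of_mem ψ (hm.feasible T hT))
    have h3 : ∫ x in 0..T, ‖inner ℝ (v x) (B (q x) (v x) (v x))‖ =
        ∫ x in 0..T, inner ℝ (v x) (B (q x) (v x) (v x)) := by
      refine intervalIntegral.integral_congr fun x hx => ?_
      rw [uIcc_of_le hT] at hx
      exact Real.norm_of_nonneg (hB.inner_nonneg (hm.mem hx.1) _)
    have h4 := finslerEnergy_nonneg (Lg := Lg) (q T) (v T)
    simp only [id]
    rw [h3]
    unfold totalEnergy at h1 ⊢
    linarith

theorem exists_tendsto_totalEnergy (hQ : IsOpen Q) (hL : IsFinslerStructure Q Lg)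
    (hf : IsBendingTerm Q f) (hc : ∀ j, ContDiffOn ℝ 2 (c j) Q)
    (hg : ∀ i, ContDiffOn ℝ 2 (g i) Q) (hψ : ContDiffOn ℝ 1 ψ Q)
    (hψb : BddBelow (ψ '' feasibleSet Q c g)) (hB : IsDamping Q B)
    (hm : IsMotion Q Lg f ψ B c g β q v) :
    ∃ e : ℝ, Tendsto (fun t => totalEnergy Lg ψ (q t) (v t)) atTop (𝓝 e) := by
  obtain ⟨p, hp⟩ := hψb
  have h1 : Antitone fun t => totalEnergy Lg ψ (q (max t 0)) (v (max t 0)) := fun s t hst =>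
    hm.totalEnergy_le hQ hL hf hc hg hψ hB (le_max_right _ _) (max_le_max_right 0 hst)
  refine ⟨_, (tendsto_atTop_ciInf h1 ⟨p, ?_⟩).congr' ?_⟩
  · rintro _ ⟨t, rfl⟩
    have h2 : p ≤ ψ (q (max t 0)) :=
      hp (mem_image_of_mem ψ (hm.feasible _ (le_max_right _ _)))
    exact h2.trans (le_add_of_nonneg_left (finslerEnergy_nonneg _ _))
  · filter_upwards [eventually_ge_atTop 0] with t ht
    rw [max_eq_left ht]

/-! ### Decay of the velocity. -/

/-- In a compact part of the coordinate domain the velocity vanishes in the long run. -/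
theorem tendsto_velocity (hQ : IsOpen Q) (hL : IsFinslerStructure Q Lg)
    (hf : IsBendingTerm Q f) (hc : ∀ j, ContDiffOn ℝ 2 (c j) Q)
    (hg : ∀ i, ContDiffOn ℝ 2 (g i) Q) (hψ : ContDiffOn ℝ 1 ψ Q)
    (hψb : BddBelow (ψ '' feasibleSet Q c g)) (hB : IsDamping Q B)
    (hm : IsMotion Q Lg f ψ B c g β q v) {K : Set (Coord d)} (hKQ : K ⊆ Q) (hK : IsCompact K) :
    Tendsto v (atTop ⊓ 𝓟 {t | q t ∈ K}) (𝓝 0) := by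
  obtain ⟨ρ, hρ, hρQ⟩ := hK.exists_cthickening_subset_open hQ hKQ
  set K' := Metric.cthickening ρ K with hK'
  have hK'c : IsCompact K' := hK.cthickening
  obtain ⟨m, hm0, hmle⟩ := exists_le_of_homogeneous two_ne_zero
    hL.contDiffOn_energy.continuousOn hL.energy_smul hL.energy_pos hK'c hρQ
  obtain ⟨C, hC, hCle⟩ := exists_norm_le_of_homogeneous two_ne_zero
    hL.contDiffOn_energy.continuousOn hL.energy_smul hK'c hρQ
  obtain ⟨V, hV, hVle⟩ := hm.exists_speed_le hQ hL hf hc hg hψ hψb hB hK'c hρQ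
  obtain ⟨b, hb, hble⟩ := hB.exists_le_inner hK'c hρQ V
  have hψu : UniformContinuousOn ψ K' :=
    hK'c.uniformContinuousOn_of_continuous (hψ.continuousOn.mono hρQ)
  obtain ⟨e, he⟩ := hm.exists_tendsto_totalEnergy hQ hL hf hc hg hψ hψb hB
  have key : ∀ δ > 0, ∀ᶠ t in atTop, q t ∈ K → finslerEnergy Lg (q t) (v t) < δ := by
    intro δ hδ
    obtain ⟨ε, hε, hεψ⟩ := Metric.uniformContinuousOn_iff_le.1 hψu (δ / 2) (half_pos hδ)
    set ρ' := min ρ ε with hρ'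
    have hρ'0 : 0 < ρ' := lt_min hρ hε
    -- At speed at most `V` the curve moves at most `ρ' / 4` in time `τ`, so it stays in `K'` and
    -- `ψ` varies by at most `δ / 2`.
    set τ := ρ' / (4 * V) with hτ
    have hτ0 : 0 < τ := by positivity
    have hτV : V * τ < ρ' / 2 := by
      have : V * τ = ρ' / 4 := by rw [hτ]; field_simp
      linarith
    have h1 : Tendsto (fun t => totalEnergy Lg ψ (q (t - τ)) (v (t - τ)) -
        totalEnergy Lg ψ (q t) (v t)) atTop (𝓝 0) := by
      have := (he.comp (tendsto_atTop_add_const_right atTop (-τ) tendsto_id)).sub he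
      rwa [sub_self] at this
    have hpos : 0 < τ * (b * (δ / (2 * C))) := by positivity
    filter_upwards [h1.eventually_lt_const hpos, eventually_ge_atTop τ] with t ht htτ htK
    by_contra hcon
    rw [not_lt] at hcon
    have h0 : 0 ≤ t - τ := sub_nonneg.2 htτ
    have hle : t - τ ≤ t := sub_le_self t hτ0.le
    have hball : Metric.closedBall (q t) ρ' ⊆ K' :=
      (Metric.closedBall_subset_closedBall (min_le_left _ _)).trans
        (Metric.closedBall_subset_cthickening htK ρ)
    have hin : ∀ s ∈ Icc (t - τ) t, q s ∈ Metric.closedBall (q t) ρ' := fun s hs =>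
      mem_closedBall_of_speed_le (V := V) (hm.continuousOn.mono fun r hr => h0.trans hr.1)
        (fun r hr => hm.velocity r (h0.trans hr.1))
        (fun r hr hr' => hVle r (h0.trans hr.1) (hball hr')) (by simpa using hτV)
        (t₀ := t) ⟨hle, le_rfl⟩ (by rw [dist_self]; positivity) hs
    have h2 := hm.totalEnergy_le_sub_integral hQ hL hf hc hg hψ hψb hB h0 hle
    -- At an earlier `s` the total energy is no smaller than at `t`, so the kinetic energy is at
    -- least `δ - δ / 2`; since it is at most `C * ‖v‖²`, this bounds the damping below.
    have h3 : ∫ r in (t - τ)..t, b * (δ / (2 * C)) ≤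
        ∫ r in (t - τ)..t, inner ℝ (v r) (B (q r) (v r) (v r)) := by
      refine intervalIntegral.integral_mono_on hle intervalIntegrable_const
        (hm.intervalIntegrable_damping hQ hL hf hc hg hψ hψb hB h0 hle) fun s hs => ?_
      have hs0 := h0.trans hs.1
      have hsK := hball (hin s hs)
      refine le_trans ?_ (hble (q s) hsK (v s) (hVle s hs0 hsK))
      have h4 := hm.totalEnergy_le hQ hL hf hc hg hψ hB hs0 hs.2
      have h5 := hεψ (q s) hsK (q t) (hball (Metric.mem_closedBall_self hρ'0.le))
        ((Metric.mem_closedBall.1 (hin s hs)).trans (min_le_right _ _))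
      have h6 := hCle (q s) hsK (v s)
      rw [Real.norm_of_nonneg (finslerEnergy_nonneg _ _)] at h6
      rw [Real.dist_eq, abs_le] at h5
      unfold totalEnergy at h4
      gcongr
      rw [div_le_iff₀ (by positivity)]
      linarith
    rw [intervalIntegral.integral_const, smul_eq_mul, sub_sub_cancel] at h3
    linarith
  rw [Metric.tendsto_nhds]
  intro ε hε
  rw [eventually_inf_principal]
  filter_upwards [key (m * ε ^ 2) (by positivity)] with t ht htK
  have h1 := hmle (q t) (Metric.self_subset_cthickening K htK) (v t)
  rw [dist_zero_right]
  have h2 := h1.trans_lt (ht htK)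
  exact lt_of_pow_lt_pow_left₀ 2 hε.le (lt_of_mul_lt_mul_left h2 hm0.le)

end IsMotion

/-! ### Descent directions and test fields. -/

/-- At a feasible point that is not a KKT point there is a feasible descent direction. -/
theorem exists_descent_direction (hcg : FullRankConstraints Q c g) {x : Coord d}
    (hx : x ∈ feasibleSet Q c g) (hxk : x ∉ kktSet Q ψ c g) :
    ∃ w : Coord d, (∀ j, inner ℝ w (gradient (c j) x) = 0) ∧
      (∀ i, g i x = 0 → 0 ≤ inner ℝ w (gradient (g i) x)) ∧
      0 < inner ℝ w (-gradient ψ x) := by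
  classical
  have hli := hcg x hx
  set n := Sum.elim (fun j : ι => gradient (c j) x)
    (fun i : {i : κ // g i x = 0} => gradient (g i) x) with hn
  -- If `-∇ψ` is a combination of active gradients, failure of KKT means that some inequality has a
  -- positive coefficient, and its dual vector is a descent direction. Otherwise the component of
  -- `-∇ψ` orthogonal to the span is one.
  by_cases hu : -gradient ψ x ∈ Submodule.span ℝ (range n)
  · obtain ⟨l, hl⟩ := (Submodule.mem_span_range_iff_exists_fun ℝ).1 hu
    have h1 : ∃ i, 0 < l (Sum.inr i) := by
      by_contra! hcon
      refine hxk ⟨hx, fun j => l (Sum.inl j),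
        fun i => if h : g i x = 0 then l (Sum.inr ⟨i, h⟩) else 0, fun i => ?_, ?_⟩
      · by_cases h : g i x = 0
        · simp [h, hcon]
        · simp [h]
      · rw [← hl, Fintype.sum_sum_type, constraintTerm]
        congr 1
        rw [← Fintype.sum_subtype_add_sum_subtype fun i => g i x = 0]
        have h2 : ∀ i : {i // ¬g i x = 0},
            (if h : g i x = 0 then l (Sum.inr ⟨i, h⟩) else 0) • gradient (g i) x = 0 := by
          rintro ⟨i, hi⟩
          rw [dif_neg hi, zero_smul]
        rw [Finset.sum_eq_zero fun i _ => h2 i, add_zero]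
        refine Finset.sum_congr rfl fun i _ => ?_
        rw [dif_pos i.2]
        rfl
    obtain ⟨i, hi⟩ := h1
    obtain ⟨e, he⟩ := hli.exists_dual_family
    refine ⟨e (Sum.inr i), fun j => ?_, fun k hk => ?_, ?_⟩
    · simpa [hn] using he (Sum.inl j) (Sum.inr i)
    · have := he (Sum.inr ⟨k, hk⟩) (Sum.inr i)
      simp only [hn, Sum.elim_inr] at this
      rw [this]
      split_ifs <;> simp
    · rw [← hl, inner_sum]
      simp only [inner_smul_right, he]
      simpa using hi
  · set S := Submodule.span ℝ (range n)
    set u := -gradient ψ x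
    have h1 : u - S.starProjection u ∈ Sᗮ := S.sub_starProjection_mem_orthogonal u
    have h2 : ∀ a, inner ℝ (u - S.starProjection u) (n a) = 0 := fun a =>
      S.inner_left_of_mem_orthogonal (Submodule.subset_span (mem_range_self a)) h1
    refine ⟨u - S.starProjection u, fun j => h2 (Sum.inl j),
      fun i hi => (h2 (Sum.inr ⟨i, hi⟩)).ge, ?_⟩
    have h3 : inner ℝ (u - S.starProjection u) (S.starProjection u) = 0 :=
      S.inner_left_of_mem_orthogonal (S.starProjection_apply_mem u) h1
    have h4 : inner ℝ (u - S.starProjection u) u =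
        inner ℝ (u - S.starProjection u) (u - S.starProjection u) := by
      rw [inner_sub_right _ u, h3, sub_zero]
    rw [h4, real_inner_self_pos]
    intro h
    rw [sub_eq_zero] at h
    exact hu (h ▸ S.starProjection_apply_mem u)

theorem contDiffAt_gradient {φ : Coord d → ℝ} {x : Coord d} {m n : WithTop ℕ∞}
    (hφ : ContDiffAt ℝ n φ x) (hmn : m + 1 ≤ n) : ContDiffAt ℝ m (gradient φ) x :=
  (rieszMap d).contDiff.contDiffAt.comp x (hφ.fderiv_right hmn)

/-- Near a feasible point that is not a KKT point there is a vector field along which contact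
forces do not push backwards, whereas the potential does push forwards. -/
theorem exists_test_field (hQ : IsOpen Q) (hc : ∀ j, ContDiffOn ℝ 2 (c j) Q)
    (hg : ∀ i, ContDiffOn ℝ 2 (g i) Q) (hcg : FullRankConstraints Q c g)
    (hψ : ContDiffOn ℝ 1 ψ Q) {x : Coord d} (hx : x ∈ feasibleSet Q c g)
    (hxk : x ∉ kktSet Q ψ c g) :
    ∃ (W : Coord d → Coord d) (γ C ρ : ℝ), 0 < γ ∧ 0 < C ∧ 0 < ρ ∧
      ∀ y ∈ Metric.closedBall x ρ, y ∈ Q ∧ DifferentiableAt ℝ W y ∧ ‖fderiv ℝ W y‖ ≤ C ∧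
        ‖W y‖ ≤ C ∧ γ ≤ inner ℝ (W y) (-gradient ψ y) ∧
        ∀ lam η, Complementary g y η → inner ℝ (constraintTerm c g y lam η) (W y) ≤ 0 := by
  classical
  obtain ⟨w, hwc, hwg, hwψ⟩ := exists_descent_direction hcg hx hxk
  have hxQ := hQ.mem_nhds hx.1
  obtain ⟨W, hWx, hWc, hWn⟩ := exists_contDiffAt_field
    (A := ι ⊕ {i : κ // g i x = 0})
    (n := Sum.elim (fun j => gradient (c j)) (fun i => gradient (g i)))
    (x := x)
    (by
      rintro (j | i)
      · exact contDiffAt_gradient ((hc j).contDiffAt hxQ) (by norm_num)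
      · exact contDiffAt_gradient ((hg i).contDiffAt hxQ) (by norm_num))
    (by
      convert hcg x hx using 2 with a
      rcases a with j | i <;> rfl) w
  have h1 : ∀ᶠ y in 𝓝 x, DifferentiableAt ℝ W y :=
    (hWc.eventually (by simp)).mono fun y hy => hy.differentiableAt one_ne_zero
  have h2 : ∀ᶠ y in 𝓝 x, ‖fderiv ℝ W y‖ < ‖fderiv ℝ W x‖ + 1 :=
    (hWc.fderiv_right (m := 0) (by norm_num)).continuousAt.norm.eventually_lt_const
      (lt_add_one _)
  have h3 : ∀ᶠ y in 𝓝 x, ‖W y‖ < ‖W x‖ + 1 :=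
    hWc.continuousAt.norm.eventually_lt_const (lt_add_one _)
  have h4 : ∀ᶠ y in 𝓝 x, inner ℝ w (-gradient ψ x) / 2 < inner ℝ (W y) (-gradient ψ y) := by
    have h5 : ContinuousAt (gradient ψ) x :=
      (contDiffAt_gradient (hψ.contDiffAt hxQ) (m := 0) (by norm_num)).continuousAt
    refine (hWc.continuousAt.inner (𝕜 := ℝ) h5.neg).eventually_const_lt ?_
    simp only [Pi.neg_apply, hWx]
    linarith
  -- No constraint becomes active nearby, so the products prescribed at `x` cover every contact
  -- force at `y`.
  have h5 : ∀ᶠ y in 𝓝 x, ∀ i, g i y = 0 → g i x = 0 := by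
    rw [eventually_all]
    intro i
    by_cases hi : g i x = 0
    · exact Eventually.of_forall fun _ _ => hi
    · filter_upwards [((hg i).contDiffAt hxQ).continuousAt.eventually_ne hi] with y hy h
      exact absurd h hy
  obtain ⟨ρ, hρ, hball⟩ := Metric.nhds_basis_closedBall.eventually_iff.1
    ((hQ.eventually_mem hx.1).and (h1.and (h2.and (h3.and (h4.and (h5.and hWn))))))
  refine ⟨W, inner ℝ w (-gradient ψ x) / 2, max (‖fderiv ℝ W x‖ + 1) (‖W x‖ + 1), ρ,
    half_pos hwψ, lt_max_of_lt_left (by positivity), hρ, fun y hy => ?_⟩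
  obtain ⟨k1, k2, k3, k4, k5, k6, k7⟩ := hball hy
  refine ⟨k1, k2, k3.le.trans (le_max_left _ _), k4.le.trans (le_max_right _ _), k5.le,
    fun lam η hη => ?_⟩
  rw [inner_constraintTerm]
  refine add_nonpos (Finset.sum_nonpos fun j _ => ?_) (Finset.sum_nonpos fun i _ => ?_)
  · have := k7 (Sum.inl j)
    simp only [Sum.elim_inl] at this
    rw [real_inner_comm, this, hwc, mul_zero]
  · rcases mul_eq_zero.1 (hη i).2 with h | h
    · rw [h, zero_mul]
    · have := k7 (Sum.inr ⟨i, k6 i h⟩)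
      simp only [Sum.elim_inr] at this
      rw [real_inner_comm, this]
      exact mul_nonpos_of_nonpos_of_nonneg (hη i).1 (hwg i (k6 i h))

/-! ### Momentum balance and accumulation points. -/

/-- The chain rule is not available at `v = 0`, but homogeneity makes the difference quotient equal
to `p(q(r), v(r)/(r - t))`, which tends to `p(q(t), a)`; differentiability of `p` at `0` identifies
this with `M a`. -/
theorem IsFinslerStructure.hasDerivWithinAt_momentum_of_eq_zero (hQ : IsOpen Q)
    (hL : IsFinslerStructure Q Lg) {a : Coord d} {t : ℝ} (hqt : q t ∈ Q) (hvt : v t = 0)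
    (hq : ContinuousWithinAt q (Ici t) t) (hv : HasDerivWithinAt v a (Ici t) t)
    (hd : DifferentiableAt ℝ (fun w => momentum (finslerEnergy Lg) (q t) w) 0) :
    HasDerivWithinAt (fun r => momentum (finslerEnergy Lg) (q r) (v r))
      (mass (finslerEnergy Lg) (q t) (v t) a) (Ici t) t := by
  have h1 : mass (finslerEnergy Lg) (q t) (v t) a = momentum (finslerEnergy Lg) (q t) a := by
    have h2 : HasDerivAt (fun s : ℝ => momentum (finslerEnergy Lg) (q t) (s • a))
        (mass (finslerEnergy Lg) (q t) (v t) a) 0 := by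
      have h3 := hd.hasFDerivAt
      rw [← zero_smul ℝ a] at h3
      have h4 := h3.comp_hasDerivAt (0 : ℝ) ((hasDerivAt_id (0 : ℝ)).smul_const a)
      rw [zero_smul, one_smul] at h4
      rw [hvt]
      exact h4
    have h3 : HasDerivWithinAt (fun s : ℝ => s • momentum (finslerEnergy Lg) (q t) a)
        (momentum (finslerEnergy Lg) (q t) a) (Ici 0) 0 := by
      have := ((hasDerivAt_id (0 : ℝ)).smul_const
        (momentum (finslerEnergy Lg) (q t) a)).hasDerivWithinAt (s := Ici 0)
      rwa [one_smul] at this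
    refine (uniqueDiffWithinAt_Ici (0 : ℝ)).eq_deriv _ h2.hasDerivWithinAt
      (h3.congr (fun s hs => ?_) ?_)
    · rw [hL.momentum_smul _ hqt a s hs, pow_one]
    · rw [hL.momentum_smul _ hqt a 0 le_rfl, pow_one]
  rw [h1, ← hasDerivWithinAt_Ioi_iff_Ici, hasDerivWithinAt_iff_tendsto_slope' (by simp)]
  have h2 := (hasDerivWithinAt_iff_tendsto_slope' (by simp)).1 hv.Ioi_of_Ici
  have h3 : Tendsto q (𝓝[>] t) (𝓝 (q t)) := hq.mono_left (nhdsWithin_mono _ Ioi_subset_Ici_self)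
  have h4 := ((hL.continuousOn_momentum hQ).continuousAt ((hQ.prod isOpen_univ).mem_nhds
    (show (q t, a) ∈ Q ×ˢ univ from ⟨hqt, mem_univ _⟩))).tendsto.comp (h3.prodMk_nhds h2)
  refine h4.congr' ?_
  filter_upwards [self_mem_nhdsWithin, h3.eventually (hQ.mem_nhds hqt)] with r hr hrQ
  have hr' : 0 ≤ (r - t)⁻¹ := inv_nonneg.2 (sub_nonneg.2 (le_of_lt hr))
  simp only [Function.comp, slope, vsub_eq_sub, hvt, hL.momentum_zero hqt, sub_zero]
  rw [hL.momentum_smul _ hrQ _ _ hr', pow_one]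

namespace IsMotion

/-- Momentum balance between impacts. -/
theorem momentum_balance (hQ : IsOpen Q) (hL : IsFinslerStructure Q Lg)
    (hm : IsMotion Q Lg f ψ B c g β q v) {t : ℝ} (ht : 0 < t) {a : Coord d}
    (hv : HasDerivAt v a t) (heq : EquationOfMotion Lg f ψ B c g β (q t) (v t) a)
    (hk : q t ∉ kktSet Q ψ c g) (hf : IsBendingTerm Q f) :
    ∃ (X : Coord d) (lam : ι → ℝ) (η : κ → ℝ) (r : Coord d),
      HasDerivWithinAt (fun s => momentum (finslerEnergy Lg) (q s) (v s)) X (Ici t) t ∧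
      Complementary g (q t) η ∧ ‖r‖ ≤ β * ‖v t‖ ∧
      X = gradient (fun x => finslerEnergy Lg x (v t)) (q t) - f (q t) (v t) -
        constraintTerm c g (q t) lam η - gradient ψ (q t) - B (q t) (v t) (v t) + r := by
  obtain ⟨lam, η, r, hη, -, -, hr, he⟩ := heq
  have hqt := hm.mem ht.le
  have hq := hm.velocity t ht.le
  by_cases h0 : v t = 0
  · have hr0 : r = 0 := by simpa [h0] using hr
    have hf0 : f (q t) 0 = 0 := apply_zero_of_homogeneous two_ne_zero hf.homogeneous hqt
    by_cases hd : DifferentiableAt ℝ (fun w => momentum (finslerEnergy Lg) (q t) w) 0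
    · refine ⟨_, lam, η, r, hL.hasDerivWithinAt_momentum_of_eq_zero hQ hqt h0
        hq.continuousWithinAt hv.hasDerivWithinAt hd, hη, hr, ?_⟩
      have h1 : geomTerm (finslerEnergy Lg) (q t) (v t) =
          -gradient (fun x => finslerEnergy Lg x (v t)) (q t) := by
        rw [geomTerm]
        conv_lhs => enter [1, 2]; rw [h0]
        rw [map_zero, zero_sub]
      rw [h1] at he
      exact sub_eq_zero.1 (Eq.trans (by abel) (sub_eq_zero.2 he))
    -- Here `mass` takes the default value `0` of `fderiv`. All velocity terms vanish as well, and
    -- the equation of motion becomes the KKT condition, excluded by `hk`.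
    · exfalso
      refine hk ⟨hm.feasible t ht.le, lam, η, hη, ?_⟩
      have h1 : mass (finslerEnergy Lg) (q t) (v t) = 0 := by
        rw [mass, h0, fderiv_zero_of_not_differentiableAt hd]
      have h2 : gradient (fun x => finslerEnergy Lg x 0) (q t) = 0 :=
        apply_zero_of_homogeneous two_ne_zero
          (φ := fun y w => gradient (fun x => finslerEnergy Lg x w) y)
          (hL.positionGradient_smul hQ) hqt
      rw [h1, geomTerm, h0, h2, hf0, hr0] at he
      simpa using he
  · refine ⟨_, lam, η, r, hL.hasDerivWithinAt_momentum hQ hqt h0 hq hv.hasDerivWithinAt, hη, hr, ?_⟩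
    rw [geomTerm] at he
    exact sub_eq_zero.1 (Eq.trans (by abel) (sub_eq_zero.2 he))

end IsMotion

namespace IsMotion

theorem mem_feasibleSet_of_mapClusterPt (hQ : IsOpen Q) (hc : ∀ j, ContDiffOn ℝ 2 (c j) Q)
    (hg : ∀ i, ContDiffOn ℝ 2 (g i) Q) (hm : IsMotion Q Lg f ψ B c g β q v) {x : Coord d}
    (hx : x ∈ Q) (hcl : MapClusterPt x atTop q) : x ∈ feasibleSet Q c g := by
  have key : ∀ (φ : Coord d → ℝ) (s : Set ℝ), ContDiffOn ℝ 2 φ Q → IsClosed s →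
      (∀ t, 0 ≤ t → φ (q t) ∈ s) → φ x ∈ s := by
    intro φ s hφ hs h
    by_contra hcon
    have h1 : ∀ᶠ y in 𝓝 x, φ y ∉ s :=
      (hφ.contDiffAt (hQ.mem_nhds hx)).continuousAt.eventually_mem (hs.isOpen_compl.mem_nhds hcon)
    obtain ⟨t, ht1, ht2⟩ := ((mapClusterPt_iff_frequently.1 hcl _ h1).and_eventually
      (eventually_ge_atTop 0)).exists
    exact ht1 (h t ht2)
  exact ⟨hx, fun j => key (c j) {0} (hc j) isClosed_singleton fun t ht => (hm.feasible t ht).2.1 j,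
    fun i => key (g i) (Ici 0) (hg i) isClosed_Ici fun t ht => (hm.feasible t ht).2.2 i⟩

theorem mem_kktSet_of_mapClusterPt (hQ : IsOpen Q) (hL : IsFinslerStructure Q Lg)
    (hf : IsBendingTerm Q f) (hc : ∀ j, ContDiffOn ℝ 2 (c j) Q)
    (hg : ∀ i, ContDiffOn ℝ 2 (g i) Q) (hcg : FullRankConstraints Q c g)
    (hψ : ContDiffOn ℝ 1 ψ Q)
    (hψb : BddBelow (ψ '' feasibleSet Q c g)) (hB : IsDamping Q B)
    (hm : IsMotion Q Lg f ψ B c g β q v) {x : Coord d} (hx : x ∈ Q)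
    (hcl : MapClusterPt x atTop q) : x ∈ kktSet Q ψ c g := by
  by_contra hxk
  obtain ⟨W, γ, A, ρ, hγ, hA, hρ, hW⟩ := exists_test_field hQ hc hg hcg hψ
    (hm.mem_feasibleSet_of_mapClusterPt hQ hc hg hx hcl) hxk
  set K := Metric.closedBall x ρ with hK
  have hKc : IsCompact K := isCompact_closedBall x ρ
  have hKQ : K ⊆ Q := fun y hy => (hW y hy).1
  obtain ⟨C₁, hC₁, hp⟩ := exists_norm_le_of_homogeneous one_ne_zero
    (hL.contDiffOn_momentum hQ).continuousOn hL.momentum_smul hKc hKQ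
  obtain ⟨C₂, hC₂, hG⟩ := exists_norm_le_of_homogeneous two_ne_zero
    (φ := fun y w => gradient (fun x => finslerEnergy Lg x w) y)
    (hL.continuousOn_positionGradient hQ) (hL.positionGradient_smul hQ) hKc hKQ
  obtain ⟨C₃, hC₃, hfC⟩ := exists_norm_le_of_homogeneous two_ne_zero hf.continuousOn
    hf.homogeneous hKc hKQ
  obtain ⟨b, hb⟩ := hB.bounded
  have hb0 : 0 ≤ b := (norm_nonneg _).trans (hb x hx 0)
  -- One `C₁` pays for the derivative of `W` along the motion; with two, `D * ε ≤ γ / 4` also gives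
  -- `|θ| ≤ γ / 8`.
  set D := A * (2 * C₁ + C₂ + C₃ + b + |β|) with hD
  have hD0 : 0 < D := by positivity
  set ε := min (min 1 (ρ / 4)) (γ / (4 * D)) with hε
  have hε0 : 0 < ε := by positivity
  have hε1 : ε ≤ 1 := (min_le_left _ _).trans (min_le_left _ _)
  have hερ : ε ≤ ρ / 4 := (min_le_left _ _).trans (min_le_right _ _)
  have hεD : D * ε ≤ γ / 4 := by
    have : ε ≤ γ / (4 * D) := min_le_right _ _
    rw [le_div_iff₀ (by positivity)] at this
    linarith
  have hslow : ∀ᶠ t in atTop, q t ∈ K → ‖v t‖ < ε := by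
    have := (hm.tendsto_velocity hQ hL hf hc hg hψ hψb hB hKQ hKc).norm.eventually_lt_const
      (by simpa using hε0)
    rwa [eventually_inf_principal] at this
  obtain ⟨T, hT⟩ := eventually_atTop.1 (hslow.and (eventually_ge_atTop 0))
  have hclose : ∃ᶠ t in atTop, dist (q t) x ≤ ρ / 2 :=
    mapClusterPt_iff_frequently.1 hcl _ (Metric.closedBall_mem_nhds x (half_pos hρ))
  obtain ⟨t₀, ht₀, ht₀T⟩ := (hclose.and_eventually (eventually_ge_atTop T)).exists
  have h0 : 0 ≤ t₀ := (hT t₀ ht₀T).2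
  -- Starting within `ρ / 2` of `x` at speed at most `ε ≤ ρ / 4`, the curve remains in `K` for unit
  -- time.
  have hin : ∀ t ∈ Icc t₀ (t₀ + 1), q t ∈ K := fun t ht =>
    mem_closedBall_of_speed_le (V := ε) (hm.continuousOn.mono fun r hr => h0.trans hr.1)
      (fun r hr => hm.velocity r (h0.trans hr.1))
      (fun r hr hr' => ((hT r (ht₀T.trans hr.1)).1 hr').le) (by linarith)
      (t₀ := t₀) ⟨le_rfl, by linarith⟩ ht₀ ht
  have hvε : ∀ t ∈ Icc t₀ (t₀ + 1), ‖v t‖ ≤ ε := fun t ht =>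
    ((hT t (ht₀T.trans ht.1)).1 (hin t ht)).le
  set θ : ℝ → ℝ := fun t => inner ℝ (W (q t)) (momentum (finslerEnergy Lg) (q t) (v t)) with hθ
  have hθb : ∀ t ∈ Icc t₀ (t₀ + 1), |θ t| ≤ γ / 8 := by
    intro t ht
    have h1 := hp (q t) (hin t ht) (v t)
    have h2 := (hW (q t) (hin t ht)).2.2.2.1
    have h3 := hvε t ht
    calc |θ t| ≤ ‖W (q t)‖ * ‖momentum (finslerEnergy Lg) (q t) (v t)‖ :=
          abs_real_inner_le_norm _ _
      _ ≤ A * (C₁ * ε) := by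
          gcongr
          refine h1.trans ?_
          rw [pow_one]
          gcongr
      _ ≤ γ / 8 := by
          have : 2 * (A * (C₁ * ε)) ≤ D * ε := by
            have : 0 ≤ A * (C₂ + C₃ + b + |β|) * ε := by positivity
            rw [hD]
            linarith
          linarith
  obtain ⟨S, hS, hSe⟩ := hm.exists_countable
  -- This forces `θ` to gain at least `γ / 2` in unit time, whereas `|θ| ≤ γ / 8` allows only `γ /
  -- 4`.
  have key := le_of_right_deriv_nonpos_off_countable
    (Φ := fun t => -θ t + (γ / 2) * (t - t₀)) (show t₀ ≤ t₀ + 1 by linarith) hS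
    (fun t ht => by
      have ht' := Ico_subset_Icc_self ht
      have h1 := hm.continuousWithinAt_comp hQ (hL.continuousOn_momentum hQ) (h0.trans ht.1)
      have h2 := ((hW (q t) (hin t ht')).2.1.continuousAt).comp_continuousWithinAt
        (hm.velocity t (h0.trans ht.1)).continuousWithinAt
      exact (h2.inner (𝕜 := ℝ) h1).neg.add (by fun_prop))
    (fun t ht => by
      have ht' := Ioc_subset_Icc_self ht
      have ht0 := h0.trans_lt ht.1
      obtain ⟨w, hw, ⟨lam, η, hη, hj⟩, -⟩ := hm.impact t ht0
      have h1 := hm.tendsto_comp hQ (hL.continuousOn_momentum hQ) ht0 hw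
      have h2 := ((hW (q t) (hin t ht')).2.1.continuousAt).tendsto.comp
        ((hm.continuousAt ht0).tendsto.mono_left (nhdsWithin_le_nhds (s := Iio t)))
      have h3 : Tendsto (fun s => (γ / 2) * (s - t₀)) (𝓝[<] t) (𝓝 ((γ / 2) * (t - t₀))) :=
        (Continuous.tendsto (by fun_prop) t).mono_left nhdsWithin_le_nhds
      refine ⟨_, (h2.inner (𝕜 := ℝ) h1).neg.add h3, ?_⟩
      -- Impulses have nonnegative product with `W`, so `θ` only jumps upwards.
      have h4 := (hW (q t) (hin t ht')).2.2.2.2.2 lam η hη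
      have h5 : momentum (finslerEnergy Lg) (q t) (v t) =
          momentum (finslerEnergy Lg) (q t) w - constraintTerm c g (q t) lam η := by
        exact sub_eq_zero.1 (Eq.trans (by abel) hj)
      rw [real_inner_comm] at h4
      simp only [hθ]
      rw [h5, inner_sub_right]
      linarith)
    (fun t ht htS => by
      have ht' := Ico_subset_Icc_self ht
      obtain ⟨ht0, a, ha, he⟩ := hSe t (h0.trans ht.1) htS
      obtain ⟨k1, k2, k3, k4, k5, k6⟩ := hW (q t) (hin t ht')
      -- At a KKT point `-∇ψ` would be a constraint term, with product at most `0` against `W`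
      -- instead of at least `γ`.
      have hk : q t ∉ kktSet Q ψ c g := by
        rintro ⟨-, lam, η, hη, hkkt⟩
        have := k6 lam η hη
        rw [hkkt, real_inner_comm] at this
        linarith
      obtain ⟨X, lam, η, r, hX, hη, hr, hXe⟩ := hm.momentum_balance hQ hL ht0 ha he hk hf
      have h1 := (k2.hasFDerivAt.comp_hasDerivWithinAt t (hm.velocity t ht0.le)).inner ℝ hX
      have h2 : HasDerivWithinAt (fun s => (γ / 2) * (s - t₀)) (γ / 2) (Ici t) t := by
        have := (((hasDerivAt_id t).sub_const t₀).const_mul (γ / 2)).hasDerivWithinAt (s := Ici t)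
        rwa [mul_one] at this
      refine ⟨_, ?_, h1.neg.add h2⟩
      have hv := hvε t ht'
      have hv2 : ‖v t‖ ^ 2 ≤ ε := by
        have := norm_nonneg (v t)
        nlinarith
      have hi : ∀ u w : Coord d, -(‖u‖ * ‖w‖) ≤ inner ℝ u w := fun u w =>
        (abs_le.1 (abs_real_inner_le_norm u w)).1
      have e1 : ‖fderiv ℝ W (q t) (v t)‖ * ‖momentum (finslerEnergy Lg) (q t) (v t)‖ ≤
          A * (C₁ * ε) := by
        have l1 := hp (q t) (hin t ht') (v t)
        rw [pow_one] at l1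
        have l2 := (fderiv ℝ W (q t)).le_of_opNorm_le k3 (v t)
        calc _ ≤ (A * ‖v t‖) * (C₁ * ‖v t‖) := by gcongr
          _ = A * (C₁ * ‖v t‖ ^ 2) := by ring
          _ ≤ _ := by gcongr
      have e2 : ‖W (q t)‖ * ‖gradient (fun x => finslerEnergy Lg x (v t)) (q t)‖ ≤
          A * (C₂ * ε) := by
        have := hG (q t) (hin t ht') (v t)
        gcongr
        exact this.trans (by gcongr)
      have e3 : ‖W (q t)‖ * ‖-f (q t) (v t)‖ ≤ A * (C₃ * ε) := by
        rw [norm_neg]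
        have := hfC (q t) (hin t ht') (v t)
        gcongr
        exact this.trans (by gcongr)
      have e4 : ‖W (q t)‖ * ‖-B (q t) (v t) (v t)‖ ≤ A * (b * ε) := by
        rw [norm_neg]
        have := (B (q t) (v t)).le_of_opNorm_le (hb (q t) k1 (v t)) (v t)
        gcongr
        exact this.trans (by gcongr)
      have e5 : ‖W (q t)‖ * ‖r‖ ≤ A * (|β| * ε) := by
        gcongr
        exact hr.trans ((mul_le_mul_of_nonneg_right (le_abs_self β) (norm_nonneg _)).trans
          (by gcongr))
      have i1 := hi (fderiv ℝ W (q t) (v t)) (momentum (finslerEnergy Lg) (q t) (v t))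
      have i2 := hi (W (q t)) (gradient (fun x => finslerEnergy Lg x (v t)) (q t))
      have i3 := hi (W (q t)) (-f (q t) (v t))
      have i4 := hi (W (q t)) (-B (q t) (v t) (v t))
      have i5 := hi (W (q t)) r
      have i6 := k6 lam η hη
      rw [real_inner_comm] at i6
      have hsum : A * (C₁ * ε) + A * (C₂ * ε) + A * (C₃ * ε) + A * (b * ε) + A * (|β| * ε) ≤
          D * ε := by
        have : 0 ≤ A * (C₁ * ε) := by positivity
        rw [hD]
        linarith
      simp only [inner_neg_right] at i3 i4 k5
      rw [hXe]
      simp only [inner_add_right, inner_sub_right]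
      simp only [Function.comp]
      linarith)
  have hb1 := abs_le.1 (hθb t₀ ⟨le_rfl, by linarith⟩)
  have hb2 := abs_le.1 (hθb (t₀ + 1) ⟨by linarith, le_rfl⟩)
  simp only [sub_self, mul_zero, add_zero, add_sub_cancel_left, mul_one] at key
  linarith [hb1.1, hb1.2, hb2.1, hb2.2]

end IsMotion

end Motion

/-! ### Limit sets of curves in compact sets. -/

section LimitSets

variable {E : Type*} [MetricSpace E] {q : ℝ → E} {K Z : Set E}

theorem exists_mapClusterPt_mem_of_frequently {s : Set E} (hK : IsCompact K)
    (hs : IsClosed s) (hqK : ∀ᶠ t in atTop, q t ∈ K) (h : ∃ᶠ t in atTop, q t ∈ s) :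
    ∃ x ∈ K ∩ s, MapClusterPt x atTop q :=
  (hK.inter_right hs).exists_mapClusterPt_of_frequently
    ((h.and_eventually hqK).mono fun _ ht => ⟨ht.2, ht.1⟩)

theorem tendsto_infDist_of_mapClusterPt (hK : IsCompact K) (hqK : ∀ᶠ t in atTop, q t ∈ K)
    (hZ : ∀ x ∈ K, MapClusterPt x atTop q → x ∈ Z) :
    Tendsto (fun t => Metric.infDist (q t) Z) atTop (𝓝 0) := by
  rw [Metric.tendsto_nhds]
  intro ε hε
  by_contra hcon
  obtain ⟨x, hx, hcl⟩ := exists_mapClusterPt_mem_of_frequently (s := {y | ε ≤ Metric.infDist y Z})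
    hK (isClosed_le continuous_const (Metric.continuous_infDist_pt Z)) hqK
    ((not_eventually.1 hcon).mono fun t ht => by
      rwa [Real.dist_0_eq_abs, abs_of_nonneg Metric.infDist_nonneg, not_lt] at ht)
  have : ε ≤ Metric.infDist x Z := hx.2
  rw [Metric.infDist_zero_of_mem (hZ x hx.1 hcl)] at this
  linarith

/-- A continuous curve in a compact set whose accumulation points are isolated from each other
converges. -/
theorem exists_tendsto_of_isolated_mapClusterPt (hq : ContinuousOn q (Ici 0)) (hK : IsCompact K)
    (hqK : ∀ᶠ t in atTop, q t ∈ K) (hZ : ∀ x ∈ K, MapClusterPt x atTop q → x ∈ Z)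
    (hiso : ∀ x ∈ Z, ∀ᶠ y in 𝓝[≠] x, y ∉ Z) : ∃ x ∈ Z, Tendsto q atTop (𝓝 x) := by
  obtain ⟨x, ⟨hxK, -⟩, hcl⟩ := exists_mapClusterPt_mem_of_frequently hK isClosed_univ hqK
    (Frequently.of_forall fun _ => mem_univ _)
  have hxZ := hZ x hxK hcl
  refine ⟨x, hxZ, ?_⟩
  obtain ⟨ρ, hρ, hball⟩ := Metric.nhdsWithin_basis_ball.eventually_iff.1 (hiso x hxZ)
  rw [Metric.tendsto_nhds]
  intro ε hε
  by_contra hcon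
  set δ := min ε ρ / 2 with hδ
  have hmin : 0 < min ε ρ := lt_min hε hρ
  have hδ0 : 0 < δ := half_pos hmin
  have hδε : δ < ε := by linarith [min_le_left ε ρ]
  have hδρ : δ < ρ := by linarith [min_le_right ε ρ]
  -- A curve that keeps returning to `x` and keeps leaving its `ε`-ball crosses this sphere at
  -- arbitrarily late times; an accumulation point there contradicts isolation of `x`.
  have hfreq : ∃ᶠ t in atTop, q t ∈ Metric.sphere x δ := by
    rw [frequently_atTop]
    intro T
    have h1 : ∃ᶠ t in atTop, dist (q t) x < δ :=
      mapClusterPt_iff_frequently.1 hcl _ (Metric.ball_mem_nhds x hδ0)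
    obtain ⟨t₁, ht₁T, ht₁⟩ := frequently_atTop.1 h1 (max T 0)
    obtain ⟨t₂, ht₂T, ht₂⟩ := frequently_atTop.1 (not_eventually.1 hcon) t₁
    have h2 : ContinuousOn (fun t => dist (q t) x) (Icc t₁ t₂) := fun t ht =>
      ((hq t (((le_max_right _ _).trans ht₁T).trans ht.1)).mono fun s hs =>
        ((le_max_right _ _).trans ht₁T).trans hs.1).dist tendsto_const_nhds
    obtain ⟨t, ht, hte⟩ := intermediate_value_Icc ht₂T h2 ⟨ht₁.le, hδε.le.trans (not_lt.1 ht₂)⟩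
    exact ⟨t, ((le_max_left _ _).trans ht₁T).trans ht.1, hte⟩
  obtain ⟨y, ⟨hyK, hy⟩, hycl⟩ :=
    exists_mapClusterPt_mem_of_frequently hK Metric.isClosed_sphere hqK hfreq
  have hy' : dist y x = δ := hy
  refine hball ⟨?_, ?_⟩ (hZ y hyK hycl)
  · rw [Metric.mem_ball, hy']
    exact hδρ
  · rintro rfl
    rw [dist_self] at hy'
    linarith

end LimitSets

/-! ### The stability theorem. -/

theorem mainTheorem3 {d : ℕ} {ι κ : Type*} [Fintype ι] [Fintype κ]
    (Q : Set (Coord d)) (hQ : IsOpen Q)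
    (Lg : Coord d → Coord d → ℝ) (hLg : IsFinslerStructure Q Lg)
    (f : Coord d → Coord d → Coord d) (hf : IsBendingTerm Q f)
    (c : ι → Coord d → ℝ) (hc : ∀ j, ContDiffOn ℝ 2 (c j) Q)
    (g : κ → Coord d → ℝ) (hg : ∀ i, ContDiffOn ℝ 2 (g i) Q)
    (hcg : FullRankConstraints Q c g)
    (ψ : Coord d → ℝ) (hψ : ContDiffOn ℝ 1 ψ Q) (hψb : BddBelow (ψ '' feasibleSet Q c g))
    (B : Coord d → Coord d → Coord d →L[ℝ] Coord d) (hB : IsDamping Q B)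
    (β : ℝ) (q v : ℝ → Coord d) (hqv : IsMotion Q Lg f ψ B c g β q v) :
    -- the total energy decreases at least at the damping rate and converges
    (IntegrableOn (fun t => inner ℝ (v t) (B (q t) (v t) (v t))) (Ici 0) ∧
      (∀ s t, 0 ≤ s → s ≤ t → totalEnergy Lg ψ (q t) (v t) ≤
        totalEnergy Lg ψ (q s) (v s) - ∫ r in s..t, inner ℝ (v r) (B (q r) (v r) (v r))) ∧
      ∃ e : ℝ, Tendsto (fun t => totalEnergy Lg ψ (q t) (v t)) atTop (𝓝 e)) ∧
    -- every accumulation point of the motion is a KKT point, approached with vanishing velocity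
    (∀ x ∈ Q, MapClusterPt x atTop q → x ∈ kktSet Q ψ c g) ∧
    (∀ K ⊆ Q, IsCompact K → Tendsto v (atTop ⊓ 𝓟 {t | q t ∈ K}) (𝓝 0)) ∧
    -- a motion that stays in a compact part of `Q` comes to rest and converges to the KKT points
    ((∃ K ⊆ Q, IsCompact K ∧ ∀ᶠ t in atTop, q t ∈ K) →
      Tendsto v atTop (𝓝 0) ∧
      (kktSet Q ψ c g).Nonempty ∧
      Tendsto (fun t => Metric.infDist (q t) (kktSet Q ψ c g)) atTop (𝓝 0) ∧
      ((∀ x ∈ kktSet Q ψ c g, ∀ᶠ y in 𝓝[≠] x, y ∉ kktSet Q ψ c g) →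
        ∃ x ∈ kktSet Q ψ c g, Tendsto q atTop (𝓝 x))) := by
  have hkkt : ∀ x ∈ Q, MapClusterPt x atTop q → x ∈ kktSet Q ψ c g := fun x hx hcl =>
    hqv.mem_kktSet_of_mapClusterPt hQ hLg hf hc hg hcg hψ hψb hB hx hcl
  have hslow : ∀ K ⊆ Q, IsCompact K → Tendsto v (atTop ⊓ 𝓟 {t | q t ∈ K}) (𝓝 0) :=
    fun K hKQ hK => hqv.tendsto_velocity hQ hLg hf hc hg hψ hψb hB hKQ hK
  refine ⟨⟨hqv.integrableOn_damping hQ hLg hf hc hg hψ hψb hB,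
    fun s t hs hst => hqv.totalEnergy_le_sub_integral hQ hLg hf hc hg hψ hψb hB hs hst,
    hqv.exists_tendsto_totalEnergy hQ hLg hf hc hg hψ hψb hB⟩, hkkt, hslow, ?_⟩
  rintro ⟨K, hKQ, hK, hqK⟩
  have hZ : ∀ x ∈ K, MapClusterPt x atTop q → x ∈ kktSet Q ψ c g := fun x hx => hkkt x (hKQ hx)
  refine ⟨?_, ?_, tendsto_infDist_of_mapClusterPt hK hqK hZ,
    exists_tendsto_of_isolated_mapClusterPt hqv.continuousOn hK hqK hZ⟩
  · have := hslow K hKQ hK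
    rwa [inf_of_le_left (le_principal_iff.2 hqK)] at this
  · obtain ⟨x, ⟨hx, -⟩, hcl⟩ := exists_mapClusterPt_mem_of_frequently hK isClosed_univ hqK
      (Frequently.of_forall fun _ => mem_univ _)
    exact ⟨x, hZ x hx hcl⟩
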